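/- A \emph{rig category} is a category $C$ with two symmetric monoidal structures $(\oplus,0)$ and $(\otimes,I)$ and natural isomorphisms $\delta_{A,B,X}\colon A\otimes(B\oplus X)\to(A\otimes B)\oplus(A\otimes X)$ and $\delta_{0,A}\colon A\otimes 0\to 0$ satisfying Laplaza's coherence laws for symmetric bimonoidal categories (the distributors $(A\oplus B)\otimes X\to(A\otimes X)\oplus(B\otimes X)$ and annihilators $0\otimes A\to 0$ on the other side being obtained from $\delta$ and $\delta_0$ by means of the symmetry of $\otimes$). Let $C$ be a rig category. The category $R(C)$ has the same objects as $C$. A morphism $A\to B$ of $R(C)$ is an equivalence class $[f]$ of morphisms $f\colon A\oplus H\to B$ of $C$, where the \emph{heap} $H$ is any object of $C$, under the equivalence relation generated by $f\sim f\circ(\mathrm{id}_A\oplus h)$ for $f\colon A\oplus H\to B$ and $h\colon H'\to H$ in $C$. The composite of $[f\colon A\oplus H\to B]$ and $[g\colon B\oplus K\to X]$ is the class of $A\oplus(H\oplus K)\cong(A\oplus H)\oplus K\xrightarrow{f\oplus\mathrm{id}}B\oplus K\xrightarrow{g}X$; the identity of $A$ is the class of the right unitor $A\oplus 0\to A$.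 The functor $D\colon C\to R(C)$ is the identity on objects and sends $f\colon A\to B$ to the class of $A\oplus 0\xrightarrow{\rho^{\oplus}}A\xrightarrow{f}B$. \textbf{Lemma.} $R(C)$ is a rig category, in which $\oplus$, $0$, $\otimes$ and $I$ are as in $C$ on objects, all monoidal coherence isomorphisms (associators and unitors) are the images under $D$ of those of $C$, and, for $f\colon A\oplus H\to B$ and $f'\colon A'\oplus H'\to B'$, \begin{itemize} \item $[f]\oplus[f']$ is the class of $(A\oplus A')\oplus(H\oplus H')\cong(A\oplus H)\oplus(A'\oplus H')\xrightarrow{f\oplus f'}B\oplus B'$, where the isomorphism exchanges the two middle summands; \item $[f]\otimes[f']$ is the class of \[(A\otimes A')\oplus H''\xrightarrow{\ \delta^{-1}\ }(A\oplus H)\otimes(A'\oplus H')\xrightarrow{\ f\otimes f'\ }B\otimes B',\] where $H''=(H\otimes A')\oplus(A\otimes H')\oplus(H\otimes H')$ and $\delta^{-1}$ denotes the inverse of the iterated distributor. \end{itemize} Moreover, with this rig structure on $R(C)$, the functor $D\colon C\to R(C)$ is a strict rig functor: it is a symmetric monoidal functor for $\oplus$ and for $\otimes$ that respects the distributors and the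 annihilators, and its structure isomorphisms $D(A)\oplus D(B)\to D(A\oplus B)$, $0\to D(0)$, $D(A)\otimes D(B)\to D(A\otimes B)$ and $I\to D(I)$ are identities. -/

import Mathlib

open CategoryTheory MonoidalCategory

attribute [-instance] CategoryTheory.catToReflQuiver

universe v u v₁ u₁ v₂ u₂

/-! ### The category of morphisms with a heap

This section concerns one monoidal category, whose product is written `⊗` as usual in Mathlib.
It is applied below to the sum `(⊕, 0)` of a rig category. -/

section Heap

/-- The objects of `R(C)`: those of `C`. -/
@[ext]
structure HeapCat (C : Type u) [Category.{v} C] [MonoidalCategory C] where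
  as : C

namespace HeapCat

variable {C : Type u} [Category.{v} C] [MonoidalCategory C]

/-- A representative of a morphism `A ⟶ B` of `R(C)`: a heap `H` and a morphism `A ⊗ H ⟶ B`. -/
structure Rep (A B : C) where
  heap : C
  hom : A ⊗ heap ⟶ B

/-- `Rep.Step f f'` says that `f'` is `f` precomposed with `id ⊗ h`, for a mediator `h`. -/
def Rep.Step {A B : C} (f f' : Rep A B) : Prop :=
  ∃ h : f'.heap ⟶ f.heap, f'.hom = A ◁ h ≫ f.hom

/-- Morphisms of `R(C)`: representatives modulo the equivalence relation generated by `Rep.Step`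
(this is what `Quot` is). -/
def Hom (A B : HeapCat C) : Type (max u v) :=
  Quot (Rep.Step (A := A.as) (B := B.as))

/-- Composition of representatives, `A ⊗ (H ⊗ K) ≅ (A ⊗ H) ⊗ K ⟶ B ⊗ K ⟶ X`. -/
def Rep.comp {A B X : C} (f : Rep A B) (g : Rep B X) : Rep A X where
  heap := f.heap ⊗ g.heap
  hom := (α_ A f.heap g.heap).inv ≫ f.hom ▷ g.heap ≫ g.hom

/-- The embedding of `C` on representatives, `A ⊗ I ≅ A ⟶ B`. -/
def Rep.ofHom {A B : C} (f : A ⟶ B) : Rep A B where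
  heap := 𝟙_ C
  hom := (ρ_ A).hom ≫ f

theorem Rep.Step.comp_left {A B X : C} {f f' : Rep A B} (h : Rep.Step f f') (g : Rep B X) :
    Rep.Step (f.comp g) (f'.comp g) := by
  obtain ⟨h, hh⟩ := h
  exact ⟨h ▷ g.heap, by simp [Rep.comp, hh]⟩

theorem Rep.Step.comp_right {A B X : C} (f : Rep A B) {g g' : Rep B X} (h : Rep.Step g g') :
    Rep.Step (f.comp g) (f.comp g') := by
  obtain ⟨h, hh⟩ := h
  exact ⟨f.heap ◁ h, by simp [Rep.comp, hh, ← whisker_exchange_assoc]⟩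

instance : Category.{max u v} (HeapCat C) where
  Hom := Hom
  id A := Quot.mk _ (Rep.ofHom (𝟙 A.as))
  comp f g := Quot.map₂ Rep.comp (fun f _ _ h => Rep.Step.comp_right f h)
    (fun _ _ g h => Rep.Step.comp_left h g) f g
  id_comp := by
    rintro A B ⟨f⟩
    refine (Quot.sound ?_).symm
    exact ⟨(λ_ f.heap).hom, by simp [Rep.comp, Rep.ofHom]⟩
  comp_id := by
    rintro A B ⟨f⟩
    refine (Quot.sound ?_).symm
    exact ⟨(ρ_ f.heap).hom, by simp [Rep.comp, Rep.ofHom]⟩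
  assoc := by
    rintro A B X Y ⟨f⟩ ⟨g⟩ ⟨k⟩
    refine (Quot.sound ?_).symm
    exact ⟨(α_ f.heap g.heap k.heap).hom, by simp [Rep.comp]⟩

/-- The morphism of `R(C)` represented by `f`. -/
def homMk {A B : HeapCat C} (f : Rep A.as B.as) : A ⟶ B := Quot.mk _ f

variable (C) in
/-- The embedding `D : C ⥤ R(C)`. -/
def embedding : C ⥤ HeapCat C where
  obj A := ⟨A⟩
  map f := homMk (Rep.ofHom f)
  map_id _ := rfl
  map_comp {A B X} f g := by
    refine (Quot.sound ?_).symm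
    exact ⟨(ρ_ (𝟙_ C)).inv, by simp [Rep.comp, Rep.ofHom]⟩

variable [SymmetricCategory C]

/-- The tensor product of representatives,
`(A ⊗ A') ⊗ (H ⊗ H') ≅ (A ⊗ H) ⊗ (A' ⊗ H') ⟶ B ⊗ B'`. -/
def Rep.tensor {A B A' B' : C} (f : Rep A B) (g : Rep A' B') : Rep (A ⊗ A') (B ⊗ B') where
  heap := f.heap ⊗ g.heap
  hom := tensorμ A A' f.heap g.heap ≫ (f.hom ⊗ₘ g.hom)

theorem Rep.Step.tensor_left {A B A' B' : C} {f f' : Rep A B} (h : Rep.Step f f')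
    (g : Rep A' B') : Rep.Step (f.tensor g) (f'.tensor g) := by
  obtain ⟨h, hh⟩ := h
  refine ⟨h ▷ g.heap, ?_⟩
  have := tensorμ_natural_right A A' h (𝟙 g.heap)
  rw [tensorHom_id] at this
  simp only [Rep.tensor, hh]
  rw [reassoc_of% this, tensorHom_comp_tensorHom, whiskerLeft_id, Category.id_comp]

theorem Rep.Step.tensor_right {A B A' B' : C} (f : Rep A B) {g g' : Rep A' B'}
    (h : Rep.Step g g') : Rep.Step (f.tensor g) (f.tensor g') := by
  obtain ⟨h, hh⟩ := h
  refine ⟨f.heap ◁ h, ?_⟩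
  have := tensorμ_natural_right A A' (𝟙 f.heap) h
  rw [id_tensorHom] at this
  simp only [Rep.tensor, hh]
  rw [reassoc_of% this, tensorHom_comp_tensorHom, whiskerLeft_id, Category.id_comp]

/-- The tensor product of morphisms of `R(C)`. -/
def tensor {A B A' B' : HeapCat C} (f : A ⟶ B) (g : A' ⟶ B') :
    (⟨A.as ⊗ A'.as⟩ : HeapCat C) ⟶ ⟨B.as ⊗ B'.as⟩ :=
  Quot.map₂ Rep.tensor (fun f _ _ h => Rep.Step.tensor_right f h)
    (fun _ _ g h => Rep.Step.tensor_left h g) f g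

variable (C) in
/-- The monoidal structure that `R(C)` inherits from `C`; the coherence isomorphisms are the images
of those of `C`. -/
@[reducible]
def tensorStruct : MonoidalCategoryStruct (HeapCat C) where
  tensorObj A B := ⟨A.as ⊗ B.as⟩
  tensorHom f g := tensor f g
  whiskerLeft A _ _ f := tensor (𝟙 A) f
  whiskerRight f B := tensor f (𝟙 B)
  tensorUnit := ⟨𝟙_ C⟩
  associator A B X := (embedding C).mapIso (α_ A.as B.as X.as)
  leftUnitor A := (embedding C).mapIso (λ_ A.as)
  rightUnitor A := (embedding C).mapIso (ρ_ A.as)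

end HeapCat

end Heap

/-! ### Rig categories -/

/-- A category with two symmetric monoidal structures: `add` is `(⊕, 0)` and `mul` is `(⊗, I)`. -/
class BisymmetricCategory (C : Type u) [Category.{v} C] where
  add : MonoidalCategory C
  addSymm : @SymmetricCategory C _ add
  mul : MonoidalCategory C
  mulSymm : @SymmetricCategory C _ mul

attribute [reducible] BisymmetricCategory.add BisymmetricCategory.addSymm
  BisymmetricCategory.mul BisymmetricCategory.mulSymm

namespace Rig

section Add

attribute [local instance] BisymmetricCategory.add BisymmetricCategory.addSymm

variable {C : Type u} [Category.{v} C] [BisymmetricCategory C]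

abbrev addObj (A B : C) : C := A ⊗ B

variable (C) in
abbrev zero : C := 𝟙_ C

abbrev addHom {A B A' B' : C} (f : A ⟶ B) (f' : A' ⟶ B') : addObj A A' ⟶ addObj B B' := f ⊗ₘ f'

abbrev addAssoc (A B X : C) : addObj (addObj A B) X ≅ addObj A (addObj B X) := α_ A B X

abbrev zeroAdd (A : C) : addObj (zero C) A ≅ A := λ_ A

abbrev addZero (A : C) : addObj A (zero C) ≅ A := ρ_ A

abbrev addSwap (A B : C) : addObj A B ≅ addObj B A := β_ A B

/-- The canonical isomorphism `(A ⊕ B) ⊕ (X ⊕ Y) ⟶ (A ⊕ X) ⊕ (B ⊕ Y)`. -/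
abbrev addMiddle (A B X Y : C) :
    addObj (addObj A B) (addObj X Y) ⟶ addObj (addObj A X) (addObj B Y) := tensorμ A B X Y

abbrev addIso {A B A' B' : C} (f : A ≅ B) (f' : A' ≅ B') : addObj A A' ≅ addObj B B' := f ⊗ᵢ f'

end Add

section Mul

attribute [local instance] BisymmetricCategory.mul BisymmetricCategory.mulSymm

variable {C : Type u} [Category.{v} C] [BisymmetricCategory C]

abbrev mulObj (A B : C) : C := A ⊗ B

variable (C) in
abbrev one : C := 𝟙_ C

abbrev mulHom {A B A' B' : C} (f : A ⟶ B) (f' : A' ⟶ B') : mulObj A A' ⟶ mulObj B B' := f ⊗ₘ f'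

abbrev mulAssoc (A B X : C) : mulObj (mulObj A B) X ≅ mulObj A (mulObj B X) := α_ A B X

abbrev oneMul (A : C) : mulObj (one C) A ≅ A := λ_ A

abbrev mulOne (A : C) : mulObj A (one C) ≅ A := ρ_ A

abbrev mulSwap (A B : C) : mulObj A B ≅ mulObj B A := β_ A B

end Mul

end Rig

infixr:65 " ⊕ᵣ " => Rig.addObj
infixr:70 " ⊗ᵣ " => Rig.mulObj
infixr:65 " ⊕ₕ " => Rig.addHom
infixr:70 " ⊗ₕ " => Rig.mulHom

/-- The data of a rig category: two symmetric monoidal structures, the distributors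
`A ⊗ (B ⊕ X) ≅ (A ⊗ B) ⊕ (A ⊗ X)` and the annihilators `A ⊗ 0 ≅ 0`. -/
class RigCategoryData (C : Type u) [Category.{v} C] extends BisymmetricCategory C where
  distrib (A B X : C) : A ⊗ᵣ (B ⊕ᵣ X) ≅ (A ⊗ᵣ B) ⊕ᵣ (A ⊗ᵣ X)
  mulZero (A : C) : A ⊗ᵣ Rig.zero C ≅ Rig.zero C

namespace Rig

variable {C : Type u} [Category.{v} C] [RigCategoryData C]

/-- The distributor `(A ⊕ B) ⊗ X ≅ (A ⊗ X) ⊕ (B ⊗ X)` on the other side. -/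
def distribRight (A B X : C) : (A ⊕ᵣ B) ⊗ᵣ X ≅ (A ⊗ᵣ X) ⊕ᵣ (B ⊗ᵣ X) :=
  mulSwap (A ⊕ᵣ B) X ≪≫ RigCategoryData.distrib X A B ≪≫ addIso (mulSwap X A) (mulSwap X B)

/-- The annihilator `0 ⊗ A ≅ 0` on the other side. -/
def zeroMul (A : C) : zero C ⊗ᵣ A ≅ zero C :=
  mulSwap (zero C) A ≪≫ RigCategoryData.mulZero A

end Rig

open Rig RigCategoryData in
/-- A rig category (symmetric bimonoidal category with invertible distributors and annihilators):
the distributors and annihilators are natural and satisfy Laplaza's coherence laws. Laplaza's two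
laws that relate the distributors, respectively the annihilators, on the two sides hold by
definition of `distribRight` and `zeroMul`. -/
class RigCategory (C : Type u) [Category.{v} C] extends RigCategoryData C where
  distrib_natural {A A' B B' X X' : C} (f : A ⟶ A') (g : B ⟶ B') (k : X ⟶ X') :
    (f ⊗ₕ (g ⊕ₕ k)) ≫ (distrib A' B' X').hom =
      (distrib A B X).hom ≫ ((f ⊗ₕ g) ⊕ₕ (f ⊗ₕ k))
  mulZero_natural {A A' : C} (f : A ⟶ A') :
    (f ⊗ₕ 𝟙 (zero C)) ≫ (mulZero A').hom = (mulZero A).hom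
  distrib_addSwap (A B X : C) :
    (distrib A B X).hom ≫ (addSwap (A ⊗ᵣ B) (A ⊗ᵣ X)).hom =
      (𝟙 A ⊗ₕ (addSwap B X).hom) ≫ (distrib A X B).hom
  distribRight_addSwap (A B X : C) :
    (distribRight A B X).hom ≫ (addSwap (A ⊗ᵣ X) (B ⊗ᵣ X)).hom =
      ((addSwap A B).hom ⊗ₕ 𝟙 X) ≫ (distribRight B A X).hom
  distrib_addAssoc (A B X Y : C) :
    (distrib A (B ⊕ᵣ X) Y).hom ≫ ((distrib A B X).hom ⊕ₕ 𝟙 (A ⊗ᵣ Y)) ≫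
        (addAssoc (A ⊗ᵣ B) (A ⊗ᵣ X) (A ⊗ᵣ Y)).hom =
      (𝟙 A ⊗ₕ (addAssoc B X Y).hom) ≫ (distrib A B (X ⊕ᵣ Y)).hom ≫
        (𝟙 (A ⊗ᵣ B) ⊕ₕ (distrib A X Y).hom)
  distribRight_addAssoc (A B X Y : C) :
    (distribRight (A ⊕ᵣ B) X Y).hom ≫ ((distribRight A B Y).hom ⊕ₕ 𝟙 (X ⊗ᵣ Y)) ≫
        (addAssoc (A ⊗ᵣ Y) (B ⊗ᵣ Y) (X ⊗ᵣ Y)).hom =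
      ((addAssoc A B X).hom ⊗ₕ 𝟙 Y) ≫ (distribRight A (B ⊕ᵣ X) Y).hom ≫
        (𝟙 (A ⊗ᵣ Y) ⊕ₕ (distribRight B X Y).hom)
  distrib_mulAssoc (A B X Y : C) :
    (distrib (A ⊗ᵣ B) X Y).hom ≫ ((mulAssoc A B X).hom ⊕ₕ (mulAssoc A B Y).hom) =
      (mulAssoc A B (X ⊕ᵣ Y)).hom ≫ (𝟙 A ⊗ₕ (distrib B X Y).hom) ≫
        (distrib A (B ⊗ᵣ X) (B ⊗ᵣ Y)).hom
  distribRight_mulAssoc (A B X Y : C) :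
    ((distribRight A B X).hom ⊗ₕ 𝟙 Y) ≫ (distribRight (A ⊗ᵣ X) (B ⊗ᵣ X) Y).hom ≫
        ((mulAssoc A X Y).hom ⊕ₕ (mulAssoc B X Y).hom) =
      (mulAssoc (A ⊕ᵣ B) X Y).hom ≫ (distribRight A B (X ⊗ᵣ Y)).hom
  distrib_distribRight_mulAssoc (A B X Y : C) :
    ((distrib A B X).hom ⊗ₕ 𝟙 Y) ≫ (distribRight (A ⊗ᵣ B) (A ⊗ᵣ X) Y).hom ≫
        ((mulAssoc A B Y).hom ⊕ₕ (mulAssoc A X Y).hom) =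
      (mulAssoc A (B ⊕ᵣ X) Y).hom ≫ (𝟙 A ⊗ₕ (distribRight B X Y).hom) ≫
        (distrib A (B ⊗ᵣ Y) (X ⊗ᵣ Y)).hom
  distrib_distribRight_addMiddle (A B X Y : C) :
    (distrib (A ⊕ᵣ B) X Y).hom ≫ ((distribRight A B X).hom ⊕ₕ (distribRight A B Y).hom) ≫
        addMiddle (A ⊗ᵣ X) (B ⊗ᵣ X) (A ⊗ᵣ Y) (B ⊗ᵣ Y) =
      (distribRight A B (X ⊕ᵣ Y)).hom ≫ ((distrib A X Y).hom ⊕ₕ (distrib B X Y).hom)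
  zeroMul_zero : (zeroMul (zero C)).hom = (mulZero (zero C)).hom
  zeroMul_add (A B : C) :
    (distrib (zero C) A B).hom ≫ ((zeroMul A).hom ⊕ₕ (zeroMul B).hom) ≫ (zeroAdd (zero C)).hom =
      (zeroMul (A ⊕ᵣ B)).hom
  add_mulZero (A B : C) :
    (distribRight A B (zero C)).hom ≫ ((mulZero A).hom ⊕ₕ (mulZero B).hom) ≫
        (zeroAdd (zero C)).hom =
      (mulZero (A ⊕ᵣ B)).hom
  zeroMul_one : (zeroMul (one C)).hom = (mulOne (zero C)).hom
  one_mulZero : (mulZero (one C)).hom = (oneMul (zero C)).hom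
  mul_mulZero (A B : C) :
    (mulZero (A ⊗ᵣ B)).hom =
      (mulAssoc A B (zero C)).hom ≫ (𝟙 A ⊗ₕ (mulZero B).hom) ≫ (mulZero A).hom
  mulZero_zeroMul (A B : C) :
    ((mulZero A).hom ⊗ₕ 𝟙 B) ≫ (zeroMul B).hom =
      (mulAssoc A (zero C) B).hom ≫ (𝟙 A ⊗ₕ (zeroMul B).hom) ≫ (mulZero A).hom
  zeroMul_mul (A B : C) :
    ((zeroMul A).hom ⊗ₕ 𝟙 B) ≫ (zeroMul B).hom =
      (mulAssoc (zero C) A B).hom ≫ (zeroMul (A ⊗ᵣ B)).hom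
  mul_zeroAdd (A B : C) :
    (distrib A (zero C) B).hom ≫ ((mulZero A).hom ⊕ₕ 𝟙 (A ⊗ᵣ B)) ≫ (zeroAdd (A ⊗ᵣ B)).hom =
      𝟙 A ⊗ₕ (zeroAdd B).hom
  mul_addZero (A B : C) :
    (distrib A B (zero C)).hom ≫ (𝟙 (A ⊗ᵣ B) ⊕ₕ (mulZero A).hom) ≫ (addZero (A ⊗ᵣ B)).hom =
      𝟙 A ⊗ₕ (addZero B).hom
  zeroAdd_mul (A B : C) :
    (distribRight (zero C) A B).hom ≫ ((zeroMul B).hom ⊕ₕ 𝟙 (A ⊗ᵣ B)) ≫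
        (zeroAdd (A ⊗ᵣ B)).hom =
      (zeroAdd A).hom ⊗ₕ 𝟙 B
  addZero_mul (A B : C) :
    (distribRight A (zero C) B).hom ≫ (𝟙 (A ⊗ᵣ B) ⊕ₕ (zeroMul B).hom) ≫
        (addZero (A ⊗ᵣ B)).hom =
      (addZero A).hom ⊗ₕ 𝟙 B
  one_distrib (A B : C) :
    (distrib (one C) A B).hom ≫ ((oneMul A).hom ⊕ₕ (oneMul B).hom) = (oneMul (A ⊕ᵣ B)).hom
  distribRight_one (A B : C) :
    (distribRight A B (one C)).hom ≫ ((mulOne A).hom ⊕ₕ (mulOne B).hom) = (mulOne (A ⊕ᵣ B)).hom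

/-! ### Rig functors -/

section Functor

variable {C : Type u₁} [Category.{v₁} C] {D : Type u₂} [Category.{v₂} D]
  [RigCategory C] [RigCategory D]

open Rig RigCategoryData BisymmetricCategory in
/-- The structure of a (strong symmetric) rig functor on `F`: `F` is a strong symmetric monoidal
functor for `⊕` and for `⊗`, and it respects the distributors and the annihilators. -/
structure RigFunctor (F : C ⥤ D) where
  add : @Functor.Braided C _ (BisymmetricCategory.add) (addSymm.toBraidedCategory) D _
    (BisymmetricCategory.add) (addSymm.toBraidedCategory) F
  mul : @Functor.Braided C _ (BisymmetricCategory.mul) (mulSymm.toBraidedCategory) D _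
    (BisymmetricCategory.mul) (mulSymm.toBraidedCategory) F
  map_distrib (A B X : C) :
    (𝟙 (F.obj A) ⊗ₕ add.μ B X) ≫ mul.μ A (B ⊕ᵣ X) ≫ F.map (distrib A B X).hom =
      (distrib (F.obj A) (F.obj B) (F.obj X)).hom ≫ (mul.μ A B ⊕ₕ mul.μ A X) ≫
        add.μ (A ⊗ᵣ B) (A ⊗ᵣ X)
  map_mulZero (A : C) :
    (𝟙 (F.obj A) ⊗ₕ add.ε) ≫ mul.μ A (zero C) ≫ F.map (mulZero A).hom =
      (mulZero (F.obj A)).hom ≫ add.ε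

/-- A rig functor is strict when `F A ⊕ F B ≅ F (A ⊕ B)`, `0 ≅ F 0`, `F A ⊗ F B ≅ F (A ⊗ B)` and
`I ≅ F I` are identities. -/
structure RigFunctor.IsStrict {F : C ⥤ D} (φ : RigFunctor F) : Prop where
  add_μ (A B : C) : ∃ h : F.obj A ⊕ᵣ F.obj B = F.obj (A ⊕ᵣ B), φ.add.μ A B = eqToHom h
  add_ε : ∃ h : Rig.zero D = F.obj (Rig.zero C), φ.add.ε = eqToHom h
  mul_μ (A B : C) : ∃ h : F.obj A ⊗ᵣ F.obj B = F.obj (A ⊗ᵣ B), φ.mul.μ A B = eqToHom h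
  mul_ε : ∃ h : Rig.one D = F.obj (Rig.one C), φ.mul.ε = eqToHom h

end Functor

/-! ### `R(C)` for a rig category `C` -/

namespace Rig

variable (C : Type u) [Category.{v} C] [RigCategory C]

/-- The category `R(C)` of a rig category `C`, formed with heaps for `⊕`. -/
abbrev RCat : Type u := @HeapCat C _ BisymmetricCategory.add

/-- The embedding `D : C ⥤ R(C)`. -/
abbrev embedding : C ⥤ RCat C := @HeapCat.embedding C _ BisymmetricCategory.add

/-- The symmetric monoidal structure `(⊕, 0)` on `R(C)`. -/
abbrev addStruct : MonoidalCategoryStruct (RCat C) :=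
  @HeapCat.tensorStruct C _ BisymmetricCategory.add BisymmetricCategory.addSymm

variable {C}

theorem addHom_comp {A B X A' B' X' : C} (f : A ⟶ B) (g : B ⟶ X) (f' : A' ⟶ B') (g' : B' ⟶ X') :
    (f ⊕ₕ f') ≫ (g ⊕ₕ g') = (f ≫ g) ⊕ₕ (f' ≫ g') :=
  @tensorHom_comp_tensorHom C _ BisymmetricCategory.add _ _ _ _ _ _ f f' g g'

theorem mulHom_comp {A B X A' B' X' : C} (f : A ⟶ B) (g : B ⟶ X) (f' : A' ⟶ B') (g' : B' ⟶ X') :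
    (f ⊗ₕ f') ≫ (g ⊗ₕ g') = (f ≫ g) ⊗ₕ (f' ≫ g') :=
  @tensorHom_comp_tensorHom C _ BisymmetricCategory.mul _ _ _ _ _ _ f f' g g'

theorem addHom_id (A B : C) : 𝟙 A ⊕ₕ 𝟙 B = 𝟙 (A ⊕ᵣ B) :=
  @id_tensorHom_id C _ BisymmetricCategory.add A B

theorem mulHom_id (A B : C) : 𝟙 A ⊗ₕ 𝟙 B = 𝟙 (A ⊗ᵣ B) :=
  @id_tensorHom_id C _ BisymmetricCategory.mul A B

theorem mulSwap_natural {A A' B B' : C} (f : A ⟶ A') (g : B ⟶ B') :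
    (f ⊗ₕ g) ≫ (mulSwap A' B').hom = (mulSwap A B).hom ≫ (g ⊗ₕ f) :=
  @BraidedCategory.braiding_naturality C _ BisymmetricCategory.mul
    BisymmetricCategory.mulSymm.toBraidedCategory _ _ _ _ f g

theorem addAssoc_natural {A A' B B' X X' : C} (f : A ⟶ A') (g : B ⟶ B') (k : X ⟶ X') :
    ((f ⊕ₕ g) ⊕ₕ k) ≫ (addAssoc A' B' X').hom = (addAssoc A B X).hom ≫ (f ⊕ₕ (g ⊕ₕ k)) :=
  @associator_naturality C _ BisymmetricCategory.add _ _ _ _ _ _ f g k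

theorem distribRight_natural {A A' B B' X X' : C} (f : A ⟶ A') (g : B ⟶ B') (k : X ⟶ X') :
    ((f ⊕ₕ g) ⊗ₕ k) ≫ (distribRight A' B' X').hom =
      (distribRight A B X).hom ≫ ((f ⊗ₕ k) ⊕ₕ (g ⊗ₕ k)) := by
  change _ ≫ (mulSwap _ _).hom ≫ (RigCategoryData.distrib _ _ _).hom ≫
    ((mulSwap _ _).hom ⊕ₕ (mulSwap _ _).hom) =
    ((mulSwap _ _).hom ≫ (RigCategoryData.distrib _ _ _).hom ≫
    ((mulSwap _ _).hom ⊕ₕ (mulSwap _ _).hom)) ≫ _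
  rw [reassoc_of% (mulSwap_natural (f ⊕ₕ g) k),
    reassoc_of% (RigCategory.distrib_natural k f g), Category.assoc, Category.assoc,
    addHom_comp, addHom_comp, mulSwap_natural, mulSwap_natural]

/-- The iterated distributor
`(A ⊕ H) ⊗ (A' ⊕ H') ≅ (A ⊗ A') ⊕ ((H ⊗ A') ⊕ (A ⊗ H') ⊕ (H ⊗ H'))`. -/
def expand (A H A' H' : C) : (A ⊕ᵣ H) ⊗ᵣ (A' ⊕ᵣ H') ≅
    (A ⊗ᵣ A') ⊕ᵣ ((H ⊗ᵣ A') ⊕ᵣ (A ⊗ᵣ H') ⊕ᵣ (H ⊗ᵣ H')) :=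
  RigCategoryData.distrib (A ⊕ᵣ H) A' H' ≪≫
    addIso (distribRight A H A') (distribRight A H H') ≪≫
    addAssoc (A ⊗ᵣ A') (H ⊗ᵣ A') ((A ⊗ᵣ H') ⊕ᵣ (H ⊗ᵣ H'))

theorem expand_natural {A B H K A' B' H' K' : C} (a : A ⟶ B) (h : H ⟶ K) (a' : A' ⟶ B')
    (h' : H' ⟶ K') :
    ((a ⊕ₕ h) ⊗ₕ (a' ⊕ₕ h')) ≫ (expand B K B' K').hom =
      (expand A H A' H').hom ≫ ((a ⊗ₕ a') ⊕ₕ ((h ⊗ₕ a') ⊕ₕ (a ⊗ₕ h') ⊕ₕ (h ⊗ₕ h'))) := by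
  change _ ≫ (RigCategoryData.distrib _ _ _).hom ≫
    ((distribRight _ _ _).hom ⊕ₕ (distribRight _ _ _).hom) ≫ (addAssoc _ _ _).hom =
    ((RigCategoryData.distrib _ _ _).hom ≫
    ((distribRight _ _ _).hom ⊕ₕ (distribRight _ _ _).hom) ≫ (addAssoc _ _ _).hom) ≫ _
  rw [reassoc_of% (RigCategory.distrib_natural (a ⊕ₕ h) a' h'), reassoc_of% addHom_comp,
    distribRight_natural, distribRight_natural, ← addHom_comp, Category.assoc, Category.assoc,
    Category.assoc, addAssoc_natural]

section Mul

attribute [local instance] BisymmetricCategory.add BisymmetricCategory.addSymm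

open HeapCat

/-- The product of representatives `f : A ⊕ H ⟶ B` and `g : A' ⊕ H' ⟶ B'`, with heap
`H'' = (H ⊗ A') ⊕ (A ⊗ H') ⊕ (H ⊗ H')`:
`(A ⊗ A') ⊕ H'' ≅ (A ⊕ H) ⊗ (A' ⊕ H') ⟶ B ⊗ B'`, where the isomorphism is the inverse distributor. -/
def repMul {A B A' B' : C} (f : Rep A B) (g : Rep A' B') : Rep (A ⊗ᵣ A') (B ⊗ᵣ B') where
  heap := (f.heap ⊗ᵣ A') ⊕ᵣ (A ⊗ᵣ g.heap) ⊕ᵣ (f.heap ⊗ᵣ g.heap)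
  hom := (expand A f.heap A' g.heap).inv ≫ (f.hom ⊗ₕ g.hom)

theorem repMul_step {A B A' B' : C} (f f' : Rep A B) (g g' : Rep A' B')
    (h : f'.heap ⟶ f.heap) (hh : f'.hom = (𝟙 A ⊕ₕ h) ≫ f.hom)
    (k : g'.heap ⟶ g.heap) (hk : g'.hom = (𝟙 A' ⊕ₕ k) ≫ g.hom) :
    Rep.Step (repMul f g) (repMul f' g') := by
  refine ⟨(h ⊗ₕ 𝟙 A') ⊕ₕ (𝟙 A ⊗ₕ k) ⊕ₕ (h ⊗ₕ k), Eq.trans ?_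
    (congrArg (· ≫ (expand A f.heap A' g.heap).inv ≫ (f.hom ⊗ₕ g.hom))
      (id_tensorHom (A ⊗ᵣ A') ((h ⊗ₕ 𝟙 A') ⊕ₕ (𝟙 A ⊗ₕ k) ⊕ₕ (h ⊗ₕ k))))⟩
  rw [← mulHom_id]
  change (expand _ _ _ _).inv ≫ (f'.hom ⊗ₕ g'.hom) =
    (_ ⊕ₕ _) ≫ (expand _ _ _ _).inv ≫ (f.hom ⊗ₕ g.hom)
  rw [hh, hk, ← mulHom_comp, Iso.inv_comp_eq, ← reassoc_of% expand_natural,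
    Iso.hom_inv_id_assoc]

theorem repMul_left {A B A' B' : C} {f f' : Rep A B} (h : Rep.Step f f') (g : Rep A' B') :
    Rep.Step (repMul f g) (repMul f' g) := by
  obtain ⟨h, hh⟩ := h
  refine repMul_step f f' g g h (by rw [hh, ← id_tensorHom]) (𝟙 _) ?_
  rw [addHom_id, Category.id_comp]

theorem repMul_right {A B A' B' : C} (f : Rep A B) {g g' : Rep A' B'} (h : Rep.Step g g') :
    Rep.Step (repMul f g) (repMul f g') := by
  obtain ⟨h, hh⟩ := h
  refine repMul_step f f g g' (𝟙 _) ?_ h (by rw [hh, ← id_tensorHom])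
  rw [addHom_id, Category.id_comp]

/-- The product `⊗` of morphisms of `R(C)`. -/
def rMul {A B A' B' : RCat C} (f : A ⟶ B) (g : A' ⟶ B') :
    (⟨A.as ⊗ᵣ A'.as⟩ : RCat C) ⟶ ⟨B.as ⊗ᵣ B'.as⟩ :=
  Quot.map₂ repMul (fun f _ _ h => repMul_right f h) (fun _ _ g h => repMul_left h g) f g

variable (C) in
/-- The symmetric monoidal structure `(⊗, I)` on `R(C)`; the coherence isomorphisms are the images
of those of `C`. -/
@[reducible]
def mulStruct : MonoidalCategoryStruct (RCat C) where
  tensorObj A B := ⟨A.as ⊗ᵣ B.as⟩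
  tensorHom f g := rMul f g
  whiskerLeft A _ _ f := rMul (𝟙 A) f
  whiskerRight f B := rMul f (𝟙 B)
  tensorUnit := ⟨one C⟩
  associator A B X := (embedding C).mapIso (mulAssoc A.as B.as X.as)
  leftUnitor A := (embedding C).mapIso (oneMul A.as)
  rightUnitor A := (embedding C).mapIso (mulOne A.as)

end Mul

end Rig

/-! Every morphism of `R(C)` factors as an inclusion `inj A H` followed by the image of a morphism
of `C` (`exists_eq_inj_comp_ofHom`), and a coherence map of `C` passes through an inclusion at the
cost of any chosen mediator on the heap (`ofHom_comp_inj`). An equation in `R(C)` thus becomes an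
equation in `C`, once a mediator between the two heaps is named.

The coherence laws cost nothing: `D` preserves composites, sums and products of morphisms
(`tensor_ofHom`, `rMul_ofHom`), so each such diagram in `R(C)` is the image of one in `C`. The work
lies in the laws that quantify over morphisms: functoriality of the two products and naturality of
the coherence isomorphisms.

For `⊕`, these say that the middle exchange `tensorμ` makes the sum a monoidal functor in two
variables, with associator, unitors and symmetry monoidal transformations. For `⊗`, the three-term
heap is avoided: the heap of an identity is `0`, which the annihilators remove, so `f ⊗ 1` needs
only the heap `H ⊗ X` (`rMul_id_right`). Every product splits in both orders into products with
identities (`rMul_eq_right_left`, `rMul_eq_left_right`), which gives interchange. Naturality is then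
checked one variable at a time, and each check rests on one of Laplaza's laws, with the symmetries
transferring results from one side to the other. -/

/-! ### Middle exchange in a symmetric monoidal category. -/

theorem tensorδ_eq_tensorμ {C : Type u} [Category.{v} C] [MonoidalCategory C]
    [SymmetricCategory C] (A B X Y : C) : tensorδ A B X Y = tensorμ A X B Y := by
  simp [tensorμ, tensorδ, SymmetricCategory.braiding_swap_eq_inv_braiding B X]

theorem tensorμ_tensorμ {C : Type u} [Category.{v} C] [MonoidalCategory C]
    [SymmetricCategory C] (A B X Y : C) : tensorμ A B X Y ≫ tensorμ A X B Y = 𝟙 _ := by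
  rw [← tensorδ_eq_tensorμ A X B Y, tensorδ_tensorμ]

theorem tensorμ_comp_braiding {C : Type u} [Category.{v} C] [MonoidalCategory C]
    [SymmetricCategory C] (A B X Y : C) :
    tensorμ A B X Y ≫ (β_ (A ⊗ X) (B ⊗ Y)).hom =
      ((β_ A B).hom ⊗ₘ (β_ X Y).hom) ≫ tensorμ B A Y X := by
  simp [tensorμ, SymmetricCategory.braiding_swap_eq_inv_braiding B X,
    MonoidalCategory.tensorHom_def]

theorem tensorμ_eq_associator_comp {C : Type u} [Category.{v} C] [MonoidalCategory C]
    [SymmetricCategory C] (A B X Y : C) :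
    tensorμ A B X Y = (α_ A B (X ⊗ Y)).hom ≫
      (A ◁ ((α_ B X Y).inv ≫ (β_ B X).hom ▷ Y ≫ (α_ X B Y).hom)) ≫ (α_ A X (B ⊗ Y)).inv := by
  simp [tensorμ]

/-! ### Calculus of inclusions and images in `R(C)`. -/

namespace HeapCat

variable {C : Type u} [Category.{v} C] [MonoidalCategory C]

/-- The inclusion `A ⟶ A ⊗ H` of `R(C)`, represented by the identity with heap `H`. -/
def inj (A H : C) : (⟨A⟩ : HeapCat C) ⟶ ⟨A ⊗ H⟩ :=
  homMk (A := ⟨A⟩) (B := ⟨A ⊗ H⟩) ⟨H, 𝟙 _⟩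

/-- The morphism of `R(C)` given by one of `C`. -/
def ofHom {A B : C} (f : A ⟶ B) : (⟨A⟩ : HeapCat C) ⟶ ⟨B⟩ := (embedding C).map f

theorem ofHom_id (A : C) : ofHom (𝟙 A) = 𝟙 (⟨A⟩ : HeapCat C) := rfl

theorem ofHom_comp {A B X : C} (f : A ⟶ B) (g : B ⟶ X) : ofHom (f ≫ g) = ofHom f ≫ ofHom g :=
  (embedding C).map_comp f g

theorem ofHom_hom_inv {A B : C} (e : A ≅ B) : ofHom e.hom ≫ ofHom e.inv = 𝟙 _ := by
  rw [← ofHom_comp, e.hom_inv_id, ofHom_id]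

theorem homMk_eq_of_whiskerLeft {A B : C} (f f' : Rep A B)
    (h : f'.heap ⟶ f.heap) (hh : f'.hom = A ◁ h ≫ f.hom) :
    homMk (A := ⟨A⟩) (B := ⟨B⟩) f = homMk (A := ⟨A⟩) (B := ⟨B⟩) f' :=
  Quot.sound ⟨h, hh⟩

theorem homMk_comp_ofHom {A B X : C} (f : Rep A B) (g : B ⟶ X) :
    homMk (A := ⟨A⟩) (B := ⟨B⟩) f ≫ ofHom g =
      homMk (A := ⟨A⟩) (B := ⟨X⟩) ⟨f.heap, f.hom ≫ g⟩ := by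
  refine (homMk_eq_of_whiskerLeft ⟨f.heap, f.hom ≫ g⟩ (f.comp (Rep.ofHom g)) (ρ_ f.heap).hom ?_).symm
  simp [Rep.comp, Rep.ofHom]

theorem ofHom_comp_homMk {A B X : C} (f : A ⟶ B) (g : Rep B X) :
    ofHom f ≫ homMk (A := ⟨B⟩) (B := ⟨X⟩) g =
      homMk (A := ⟨A⟩) (B := ⟨X⟩) ⟨g.heap, f ▷ g.heap ≫ g.hom⟩ := by
  refine (homMk_eq_of_whiskerLeft ⟨g.heap, f ▷ g.heap ≫ g.hom⟩ ((Rep.ofHom f).comp g)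
    (λ_ g.heap).hom ?_).symm
  simp [Rep.comp, Rep.ofHom]

theorem inj_comp_ofHom {A H B : C} (f : A ⊗ H ⟶ B) :
    inj A H ≫ ofHom f = homMk (A := ⟨A⟩) (B := ⟨B⟩) ⟨H, f⟩ := by
  refine (homMk_comp_ofHom ⟨H, 𝟙 (A ⊗ H)⟩ f).trans ?_
  rw [Category.id_comp]

/-- The normal form behind all later computations: once heaps are isolated in `inj`, only morphisms
of `C` remain to be compared. -/
theorem exists_eq_inj_comp_ofHom {A B : C} (f : (⟨A⟩ : HeapCat C) ⟶ ⟨B⟩) :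
    ∃ (H : C) (k : A ⊗ H ⟶ B), f = inj A H ≫ ofHom k := by
  obtain ⟨f⟩ := f
  exact ⟨f.heap, f.hom, (inj_comp_ofHom f.hom).symm⟩

/-- Two representatives agree as soon as one is obtained from the other by means of a mediator. -/
theorem inj_comp_ofHom_congr {A H K B : C} (h : H ⟶ K) {f : A ⊗ H ⟶ B} {g : A ⊗ K ⟶ B}
    (w : f = (𝟙 A ⊗ₘ h) ≫ g) :
    inj A H ≫ ofHom f = inj A K ≫ ofHom g := by
  rw [inj_comp_ofHom, inj_comp_ofHom]
  exact (homMk_eq_of_whiskerLeft ⟨K, g⟩ ⟨H, f⟩ h (by rw [w, id_tensorHom])).symm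

/-- The mediator `h` is arbitrary. In naturality proofs `f` is a coherence map and `h` is chosen as
the matching coherence map on heaps. -/
theorem ofHom_comp_inj {A B H K : C} (f : A ⟶ B) (h : H ⟶ K) :
    ofHom f ≫ inj B K = inj A H ≫ ofHom (f ⊗ₘ h) := by
  rw [inj, ofHom_comp_homMk, ← inj_comp_ofHom, Category.comp_id]
  exact (inj_comp_ofHom_congr h (by simp [MonoidalCategory.tensorHom_def'])).symm

theorem inj_comp_inj (A H K : C) :
    inj A H ≫ inj (A ⊗ H) K = inj A (H ⊗ K) ≫ ofHom (α_ A H K).inv := by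
  rw [inj_comp_ofHom]
  change homMk (A := ⟨A⟩) (B := ⟨(A ⊗ H) ⊗ K⟩) (Rep.comp ⟨H, 𝟙 (A ⊗ H)⟩ ⟨K, 𝟙 ((A ⊗ H) ⊗ K)⟩) = _
  simp only [Rep.comp, id_whiskerRight, Category.comp_id]

theorem ofHom_eq_inj_comp_ofHom {A B : C} (f : A ⟶ B) :
    ofHom f = inj A (𝟙_ C) ≫ ofHom ((ρ_ A).hom ≫ f) :=
  (inj_comp_ofHom _).symm

theorem inj_comp_ofHom_comp {A H B K X : C} (f : A ⊗ H ⟶ B) (g : B ⊗ K ⟶ X) :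
    (inj A H ≫ ofHom f) ≫ inj B K ≫ ofHom g =
      inj A (H ⊗ K) ≫ ofHom ((α_ A H K).inv ≫ (f ⊗ₘ 𝟙 K) ≫ g) := by
  rw [Category.assoc, reassoc_of% (ofHom_comp_inj f (𝟙 K)), reassoc_of% inj_comp_inj, ofHom_comp, ofHom_comp]

/-! ### The symmetric monoidal structure inherited by `R(C)`. -/

variable [SymmetricCategory C]

theorem tensor_inj_comp_ofHom {A H B A' H' B' : C} (f : A ⊗ H ⟶ B) (g : A' ⊗ H' ⟶ B') :
    tensor (inj A H ≫ ofHom f) (inj A' H' ≫ ofHom g) =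
      inj (A ⊗ A') (H ⊗ H') ≫ ofHom (tensorμ A A' H H' ≫ (f ⊗ₘ g)) := by
  rw [inj_comp_ofHom, inj_comp_ofHom, inj_comp_ofHom]; rfl

/-- The two unit heaps merge along `λ_ (𝟙_ C)`; the equation is the compatibility of right unitors
with the middle exchange. -/
theorem tensor_ofHom {A B A' B' : C} (f : A ⟶ B) (g : A' ⟶ B') :
    tensor (ofHom f) (ofHom g) = ofHom (f ⊗ₘ g) := by
  rw [ofHom_eq_inj_comp_ofHom f, ofHom_eq_inj_comp_ofHom g, tensor_inj_comp_ofHom,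
    ofHom_eq_inj_comp_ofHom (f ⊗ₘ g)]
  refine inj_comp_ofHom_congr (λ_ (𝟙_ C)).hom ?_
  rw [← tensorHom_comp_tensorHom, rightUnitor_monoidal, Category.assoc, Category.assoc,
    reassoc_of% tensorμ_tensorμ, id_tensorHom]

theorem tensor_comp {A B X A' B' X' : HeapCat C} (f : A ⟶ B) (f' : A' ⟶ B') (g : B ⟶ X)
    (g' : B' ⟶ X') : tensor f f' ≫ tensor g g' = tensor (f ≫ g) (f' ≫ g') := by
  obtain ⟨H, f, rfl⟩ := exists_eq_inj_comp_ofHom f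
  obtain ⟨H', f', rfl⟩ := exists_eq_inj_comp_ofHom f'
  obtain ⟨K, g, rfl⟩ := exists_eq_inj_comp_ofHom g
  obtain ⟨K', g', rfl⟩ := exists_eq_inj_comp_ofHom g'
  rw [inj_comp_ofHom_comp, inj_comp_ofHom_comp, tensor_inj_comp_ofHom, tensor_inj_comp_ofHom,
    tensor_inj_comp_ofHom, inj_comp_ofHom_comp]
  -- The heaps `(H ⊗ H') ⊗ (K ⊗ K')` and `(H ⊗ K) ⊗ (H' ⊗ K')` differ by a middle exchange; what
  -- remains is the associativity of `tensorμ` together with its naturality.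
  refine inj_comp_ofHom_congr (tensorμ H H' K K') ?_
  have h := tensor_associativity A.as A'.as H H' K K'
  have n := tensorμ_natural f f' (𝟙 K) (𝟙 K')
  rw [id_tensorHom_id] at n
  rw [← cancel_epi (α_ _ _ _).hom, Iso.hom_inv_id_assoc, ← tensorHom_comp_tensorHom (α_ _ _ _).inv,
    id_tensorHom, ← reassoc_of% h, tensorHom_comp_tensorHom_assoc, Iso.hom_inv_id, Iso.hom_inv_id,
    id_tensorHom_id, Category.id_comp, ← tensorHom_comp_tensorHom (f ⊗ₘ 𝟙 K), ← reassoc_of% n,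
    ← tensorHom_id, tensorHom_comp_tensorHom_assoc, Category.comp_id]

/-- The heaps are reassociated by `α_ H K L`, and the equation left in `C` says that the associator
is monoidal for the middle exchange. -/
theorem tensor_associator {A B X A' B' X' : HeapCat C} (f : A ⟶ A') (g : B ⟶ B') (k : X ⟶ X') :
    tensor (tensor f g) k ≫ ofHom (α_ A'.as B'.as X'.as).hom =
      ofHom (α_ A.as B.as X.as).hom ≫ tensor f (tensor g k) := by
  obtain ⟨H, f, rfl⟩ := exists_eq_inj_comp_ofHom f
  obtain ⟨K, g, rfl⟩ := exists_eq_inj_comp_ofHom g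
  obtain ⟨L, k, rfl⟩ := exists_eq_inj_comp_ofHom k
  rw [tensor_inj_comp_ofHom, tensor_inj_comp_ofHom, tensor_inj_comp_ofHom, tensor_inj_comp_ofHom,
    reassoc_of% (ofHom_comp_inj _ (α_ H K L).hom), Category.assoc, ← ofHom_comp, ← ofHom_comp]
  have h := associator_monoidal A.as B.as X.as H K L
  congr 2
  have e : (A.as ⊗ H) ◁ tensorμ B.as X.as K L ≫ (f ⊗ₘ (g ⊗ₘ k)) =
      f ⊗ₘ (tensorμ B.as X.as K L ≫ (g ⊗ₘ k)) := by
    rw [← id_tensorHom, tensorHom_comp_tensorHom, Category.id_comp]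
  have e' : tensorμ A.as B.as H K ▷ (X.as ⊗ L) ≫ ((f ⊗ₘ g) ⊗ₘ k) =
      (tensorμ A.as B.as H K ≫ (f ⊗ₘ g)) ⊗ₘ k := by
    rw [← tensorHom_id, tensorHom_comp_tensorHom, Category.id_comp]
  rw [← e, ← e', Category.assoc, Category.assoc, associator_naturality, reassoc_of% h]

theorem tensor_leftUnitor {A B : HeapCat C} (f : A ⟶ B) :
    tensor (𝟙 ⟨𝟙_ C⟩) f ≫ ofHom (λ_ B.as).hom = ofHom (λ_ A.as).hom ≫ f := by
  obtain ⟨H, f, rfl⟩ := exists_eq_inj_comp_ofHom f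
  rw [← ofHom_id, ofHom_eq_inj_comp_ofHom, tensor_inj_comp_ofHom,
    reassoc_of% (ofHom_comp_inj _ (λ_ H).hom), leftUnitor_monoidal, Category.assoc, ← ofHom_comp,
    ← ofHom_comp, Category.comp_id, ← unitors_equal]
  congr 2
  simp only [Category.assoc, MonoidalCategory.tensorHom_def, leftUnitor_naturality]

theorem tensor_braiding {A B A' B' : HeapCat C} (f : A ⟶ B) (g : A' ⟶ B') :
    tensor f g ≫ ofHom (β_ B.as B'.as).hom = ofHom (β_ A.as A'.as).hom ≫ tensor g f := by
  obtain ⟨H, f, rfl⟩ := exists_eq_inj_comp_ofHom f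
  obtain ⟨K, g, rfl⟩ := exists_eq_inj_comp_ofHom g
  rw [tensor_inj_comp_ofHom, tensor_inj_comp_ofHom, reassoc_of% (ofHom_comp_inj _ (β_ H K).hom),
    Category.assoc, ← ofHom_comp, ← ofHom_comp, ← reassoc_of% tensorμ_comp_braiding,
    Category.assoc, BraidedCategory.braiding_naturality]

theorem tensor_rightUnitor {A B : HeapCat C} (f : A ⟶ B) :
    tensor f (𝟙 ⟨𝟙_ C⟩) ≫ ofHom (ρ_ B.as).hom = ofHom (ρ_ A.as).hom ≫ f := by
  rw [← braiding_leftUnitor, ← braiding_leftUnitor, ofHom_comp, ofHom_comp, ← Category.assoc]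
  refine (congrArg (· ≫ ofHom (λ_ B.as).hom) (tensor_braiding f (𝟙 (⟨𝟙_ C⟩ : HeapCat C)))).trans ?_
  rw [Category.assoc, Category.assoc, tensor_leftUnitor]

variable (C) in
/-- The monoidal category `R(C)`. -/
@[reducible]
def monoidalCategory : MonoidalCategory (HeapCat C) :=
  letI := tensorStruct C
  MonoidalCategory.ofTensorHom
    (id_tensorHom_id := fun A B => by
      refine (tensor_ofHom (𝟙 A.as) (𝟙 B.as)).trans ?_
      rw [id_tensorHom_id]; rfl)
    (id_tensorHom := fun _ _ _ _ => rfl)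
    (tensorHom_id := fun _ _ => rfl)
    (tensorHom_comp_tensorHom := fun f f' g g' => tensor_comp f f' g g')
    (associator_naturality := fun f g k => tensor_associator f g k)
    (leftUnitor_naturality := fun f => tensor_leftUnitor f)
    (rightUnitor_naturality := fun f => tensor_rightUnitor f)
    (pentagon := fun W X Y Z => by
      -- Every arrow of the diagram is an image under `D`, so the law is the image of the pentagon
      -- of `C`.
      change tensor (ofHom _) (ofHom (𝟙 _)) ≫ ofHom _ ≫ tensor (ofHom (𝟙 _)) (ofHom _) =
        ofHom _ ≫ ofHom _
      rw [tensor_ofHom, tensor_ofHom, ← ofHom_comp, ← ofHom_comp, ← ofHom_comp, tensorHom_id, id_tensorHom]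
      exact congrArg ofHom (pentagon _ _ _ _))
    (triangle := fun X Y => by
      change ofHom _ ≫ tensor (ofHom (𝟙 _)) (ofHom _) = tensor (ofHom _) (ofHom (𝟙 _))
      rw [tensor_ofHom, tensor_ofHom, ← ofHom_comp, tensorHom_id, id_tensorHom]
      exact congrArg ofHom (triangle _ _))

attribute [local instance] monoidalCategory

variable (C) in
/-- The symmetry of `R(C)` is the image of that of `C`. -/
@[reducible]
def symmetricCategory : SymmetricCategory (HeapCat C) where
  braiding A B := (embedding C).mapIso (β_ A.as B.as)
  braiding_naturality_right X _ _ f := tensor_braiding (𝟙 X) f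
  braiding_naturality_left f Z := tensor_braiding f (𝟙 Z)
  hexagon_forward X Y Z := by
    change ofHom _ ≫ ofHom _ ≫ ofHom _ = tensor (ofHom _) (ofHom (𝟙 _)) ≫ ofHom _ ≫
      tensor (ofHom (𝟙 _)) (ofHom _)
    rw [tensor_ofHom, tensor_ofHom, ← ofHom_comp, ← ofHom_comp, ← ofHom_comp, ← ofHom_comp,
      tensorHom_id, id_tensorHom]
    exact congrArg ofHom (BraidedCategory.hexagon_forward _ _ _)
  hexagon_reverse X Y Z := by
    change ofHom _ ≫ ofHom _ ≫ ofHom _ = tensor (ofHom (𝟙 _)) (ofHom _) ≫ ofHom _ ≫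
      tensor (ofHom _) (ofHom (𝟙 _))
    rw [tensor_ofHom, tensor_ofHom, ← ofHom_comp, ← ofHom_comp, ← ofHom_comp, ← ofHom_comp,
      tensorHom_id, id_tensorHom]
    exact congrArg ofHom (BraidedCategory.hexagon_reverse _ _ _)
  symmetry X Y := ofHom_hom_inv (β_ X.as Y.as) |> fun h => by
    rw [← SymmetricCategory.braiding_swap_eq_inv_braiding] at h; exact h

attribute [local instance] symmetricCategory

variable (C) in
/-- The embedding `D : C ⥤ R(C)` is a strict symmetric monoidal functor. -/
@[reducible]
def embeddingBraided : (embedding C).Braided where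
  toMonoidal := Functor.CoreMonoidal.toMonoidal
    { εIso := Iso.refl _
      μIso _ _ := Iso.refl _
      μIso_hom_natural_left {A B} f X := by
        change tensor (ofHom f) (ofHom (𝟙 X)) ≫ 𝟙 _ = 𝟙 _ ≫ ofHom (f ▷ X)
        rw [Category.id_comp, Category.comp_id, ← tensorHom_id, tensor_ofHom]
      μIso_hom_natural_right X f := by
        change tensor (ofHom (𝟙 X)) (ofHom f) ≫ 𝟙 _ = 𝟙 _ ≫ ofHom (X ◁ f)
        rw [Category.id_comp, Category.comp_id, ← id_tensorHom, tensor_ofHom]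
      associativity X Y Z := by
        change tensor (ofHom (𝟙 (X ⊗ Y))) (ofHom (𝟙 Z)) ≫ 𝟙 _ ≫ ofHom (α_ X Y Z).hom =
          ofHom (α_ X Y Z).hom ≫ tensor (ofHom (𝟙 X)) (ofHom (𝟙 (Y ⊗ Z))) ≫ 𝟙 _
        rw [Category.id_comp, Category.comp_id, tensor_ofHom, tensor_ofHom, id_tensorHom_id,
          id_tensorHom_id, ← ofHom_comp, ← ofHom_comp, Category.id_comp, Category.comp_id]
      left_unitality X := by
        change ofHom (λ_ X).hom =
          tensor (ofHom (𝟙 (𝟙_ C))) (ofHom (𝟙 X)) ≫ 𝟙 _ ≫ ofHom (λ_ X).hom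
        rw [Category.id_comp, tensor_ofHom, id_tensorHom_id, ← ofHom_comp, Category.id_comp]
      right_unitality X := by
        change ofHom (ρ_ X).hom =
          tensor (ofHom (𝟙 X)) (ofHom (𝟙 (𝟙_ C))) ≫ 𝟙 _ ≫ ofHom (ρ_ X).hom
        rw [Category.id_comp, tensor_ofHom, id_tensorHom_id, ← ofHom_comp, Category.id_comp] }
  braided X Y := (Category.id_comp _).trans (Category.comp_id _).symm

end HeapCat

/-! ### Naturality and coherence of `⊗` in `C`, with identities in place of whiskerings. -/

namespace Rig

section

attribute [local instance] BisymmetricCategory.mul BisymmetricCategory.mulSymm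

variable {C : Type u} [Category.{v} C] [BisymmetricCategory C]

/-- The product `⊗` of two isomorphisms. -/
abbrev mulIso {A B A' B' : C} (e : A ≅ B) (e' : A' ≅ B') : A ⊗ᵣ A' ≅ B ⊗ᵣ B' := e ⊗ᵢ e'

theorem mulHom_id_eq_whiskerRight {A B : C} (f : A ⟶ B) (X : C) : f ⊗ₕ 𝟙 X = f ▷ X :=
  tensorHom_id f X

theorem id_mulHom_eq_whiskerLeft (X : C) {A B : C} (f : A ⟶ B) : 𝟙 X ⊗ₕ f = X ◁ f :=
  id_tensorHom X f

theorem mulHom_comp_id {A B X : C} (f : A ⟶ B) (g : B ⟶ X) (Y : C) :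
    (f ⊗ₕ 𝟙 Y) ≫ (g ⊗ₕ 𝟙 Y) = (f ≫ g) ⊗ₕ 𝟙 Y := by
  rw [tensorHom_comp_tensorHom, Category.comp_id]

theorem mulHom_id_comp {A B X : C} (f : A ⟶ B) (g : B ⟶ X) (Y : C) :
    (𝟙 Y ⊗ₕ f) ≫ (𝟙 Y ⊗ₕ g) = 𝟙 Y ⊗ₕ (f ≫ g) := by
  rw [tensorHom_comp_tensorHom, Category.comp_id]

theorem mulAssoc_natural {A A' B B' X X' : C} (f : A ⟶ A') (g : B ⟶ B') (k : X ⟶ X') :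
    ((f ⊗ₕ g) ⊗ₕ k) ≫ (mulAssoc A' B' X').hom = (mulAssoc A B X).hom ≫ (f ⊗ₕ (g ⊗ₕ k)) :=
  associator_naturality f g k

theorem oneMul_natural {A B : C} (f : A ⟶ B) :
    (𝟙 (one C) ⊗ₕ f) ≫ (oneMul B).hom = (oneMul A).hom ≫ f := by
  rw [← leftUnitor_naturality, ← id_tensorHom]

theorem mulOne_natural {A B : C} (f : A ⟶ B) :
    (f ⊗ₕ 𝟙 (one C)) ≫ (mulOne B).hom = (mulOne A).hom ≫ f := by
  rw [← rightUnitor_naturality, ← tensorHom_id]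

theorem mul_pentagon (W X Y Z : C) :
    ((mulAssoc W X Y).hom ⊗ₕ 𝟙 Z) ≫ (mulAssoc W (X ⊗ᵣ Y) Z).hom ≫
        (𝟙 W ⊗ₕ (mulAssoc X Y Z).hom) =
      (mulAssoc (W ⊗ᵣ X) Y Z).hom ≫ (mulAssoc W X (Y ⊗ᵣ Z)).hom := by
  rw [← pentagon, ← id_tensorHom, ← tensorHom_id]

theorem mul_triangle (X Y : C) :
    (mulAssoc X (one C) Y).hom ≫ (𝟙 X ⊗ₕ (oneMul Y).hom) = (mulOne X).hom ⊗ₕ 𝟙 Y := by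
  exact (congrArg _ (id_tensorHom _ _)).trans ((triangle _ _).trans (tensorHom_id _ _).symm)

theorem mul_hexagon_forward (X Y Z : C) :
    (mulAssoc X Y Z).hom ≫ (mulSwap X (Y ⊗ᵣ Z)).hom ≫ (mulAssoc Y Z X).hom =
      ((mulSwap X Y).hom ⊗ₕ 𝟙 Z) ≫ (mulAssoc Y X Z).hom ≫ (𝟙 Y ⊗ₕ (mulSwap X Z).hom) := by
  rw [BraidedCategory.hexagon_forward, ← tensorHom_id, ← id_tensorHom]

theorem mul_hexagon_reverse (X Y Z : C) :
    (mulAssoc X Y Z).inv ≫ (mulSwap (X ⊗ᵣ Y) Z).hom ≫ (mulAssoc Z X Y).inv =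
      (𝟙 X ⊗ₕ (mulSwap Y Z).hom) ≫ (mulAssoc X Z Y).inv ≫ ((mulSwap X Z).hom ⊗ₕ 𝟙 Y) := by
  rw [BraidedCategory.hexagon_reverse, ← tensorHom_id, ← id_tensorHom]

end

/-! ### Expansion of products of sums in `C`. -/

section

attribute [local instance] BisymmetricCategory.add BisymmetricCategory.addSymm

open HeapCat RigCategoryData RigCategory

variable {C : Type u} [Category.{v} C] [RigCategory C]

theorem addZero_natural {A B : C} (f : A ⟶ B) :
    (f ⊕ₕ 𝟙 (zero C)) ≫ (addZero B).hom = (addZero A).hom ≫ f := by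
  rw [← rightUnitor_naturality, ← tensorHom_id]

theorem addAssoc_inv_natural {A A' B B' X X' : C} (f : A ⟶ A') (g : B ⟶ B') (k : X ⟶ X') :
    (f ⊕ₕ (g ⊕ₕ k)) ≫ (addAssoc A' B' X').inv = (addAssoc A B X).inv ≫ ((f ⊕ₕ g) ⊕ₕ k) :=
  associator_inv_naturality f g k

theorem addAssoc_addZero (A B : C) :
    (addAssoc A B (zero C)).hom ≫ (𝟙 A ⊕ₕ (addZero B).hom) = (addZero (A ⊕ᵣ B)).hom := by
  rw [rightUnitor_tensor_hom, ← id_tensorHom]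

theorem addHom_hom_inv {A B A' B' : C} (e : A ≅ B) (e' : A' ≅ B') :
    (e.hom ⊕ₕ e'.hom) ≫ (e.inv ⊕ₕ e'.inv) = 𝟙 (A ⊕ᵣ A') := (addIso e e').hom_inv_id

theorem addMiddle_eq (A B X Y : C) :
    addMiddle A B X Y ≫ (addAssoc A X (B ⊕ᵣ Y)).hom = (addAssoc A B (X ⊕ᵣ Y)).hom ≫
      (𝟙 A ⊕ₕ ((addAssoc B X Y).inv ≫ ((addSwap B X).hom ⊕ₕ 𝟙 Y) ≫ (addAssoc X B Y).hom)) := by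
  rw [addMiddle, tensorμ_eq_associator_comp, Category.assoc, Category.assoc, Iso.inv_hom_id,
    Category.comp_id, ← id_tensorHom, ← tensorHom_id]

theorem addMiddle_addMiddle (A B X Y : C) : addMiddle A B X Y ≫ addMiddle A X B Y = 𝟙 _ :=
  tensorμ_tensorμ A B X Y

theorem mulSwap_mulSwap (A B : C) : (mulSwap A B).hom ≫ (mulSwap B A).hom = 𝟙 (A ⊗ᵣ B) :=
  @SymmetricCategory.symmetry C _ BisymmetricCategory.mul BisymmetricCategory.mulSymm A B

theorem mulSwap_distrib (A B X : C) :
    (mulSwap (A ⊕ᵣ B) X).hom ≫ (distrib X A B).hom =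
      (distribRight A B X).hom ≫ ((mulSwap A X).hom ⊕ₕ (mulSwap B X).hom) := by
  change _ = ((mulSwap _ _).hom ≫ (distrib _ _ _).hom ≫
    ((mulSwap _ _).hom ⊕ₕ (mulSwap _ _).hom)) ≫ _
  rw [Category.assoc, Category.assoc, addHom_comp, mulSwap_mulSwap, mulSwap_mulSwap, addHom_id,
    Category.comp_id]

theorem mulSwap_distribRight (A B X : C) :
    (mulSwap X (A ⊕ᵣ B)).hom ≫ (distribRight A B X).hom =
      (distrib X A B).hom ≫ ((mulSwap X A).hom ⊕ₕ (mulSwap X B).hom) := by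
  change _ ≫ (mulSwap _ _).hom ≫ (distrib _ _ _).hom ≫
    ((mulSwap _ _).hom ⊕ₕ (mulSwap _ _).hom) = _
  rw [reassoc_of% mulSwap_mulSwap]

theorem distrib_inv_natural {A A' B B' X X' : C} (f : A ⟶ A') (g : B ⟶ B') (k : X ⟶ X') :
    ((f ⊗ₕ g) ⊕ₕ (f ⊗ₕ k)) ≫ (distrib A' B' X').inv =
      (distrib A B X).inv ≫ (f ⊗ₕ (g ⊕ₕ k)) := by
  rw [Iso.comp_inv_eq, Category.assoc, distrib_natural, Iso.inv_hom_id_assoc]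

theorem distribRight_inv_natural {A A' B B' X X' : C} (f : A ⟶ A') (g : B ⟶ B') (k : X ⟶ X') :
    ((f ⊗ₕ k) ⊕ₕ (g ⊗ₕ k)) ≫ (distribRight A' B' X').inv =
      (distribRight A B X).inv ≫ ((f ⊕ₕ g) ⊗ₕ k) := by
  rw [Iso.comp_inv_eq, Category.assoc, distribRight_natural, Iso.inv_hom_id_assoc]

theorem expand_hom (A H A' H' : C) : (expand A H A' H').hom = (distrib (A ⊕ᵣ H) A' H').hom ≫
    ((distribRight A H A').hom ⊕ₕ (distribRight A H H').hom) ≫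
      (addAssoc (A ⊗ᵣ A') (H ⊗ᵣ A') ((A ⊗ᵣ H') ⊕ᵣ (H ⊗ᵣ H'))).hom := rfl

theorem expand_inv (A H A' H' : C) : (expand A H A' H').inv =
    (addAssoc (A ⊗ᵣ A') (H ⊗ᵣ A') ((A ⊗ᵣ H') ⊕ᵣ (H ⊗ᵣ H'))).inv ≫
      ((distribRight A H A').inv ⊕ₕ (distribRight A H H').inv) ≫
        (distrib (A ⊕ᵣ H) A' H').inv := Category.assoc _ _ _

/-- When the second heap is `0`, the annihilators collapse the last two summands, leaving `H ⊗ X`.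
The laws used are `mul_addZero` and `add_mulZero`. -/
theorem expand_zero (A H X : C) :
    ∃ m : (H ⊗ᵣ X) ⊕ᵣ (A ⊗ᵣ zero C) ⊕ᵣ (H ⊗ᵣ zero C) ⟶ H ⊗ᵣ X,
      (expand A H X (zero C)).hom ≫ (𝟙 (A ⊗ᵣ X) ⊕ₕ m) =
        (𝟙 (A ⊕ᵣ H) ⊗ₕ (addZero X).hom) ≫ (distribRight A H X).hom := by
  refine ⟨(𝟙 (H ⊗ᵣ X) ⊕ₕ (((mulZero A).hom ⊕ₕ (mulZero H).hom) ≫ (zeroAdd (zero C)).hom)) ≫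
    (addZero (H ⊗ᵣ X)).hom, ?_⟩
  rw [← mul_addZero, Category.assoc, Category.assoc, ← addZero_natural, expand_hom, Category.assoc,
    ← addAssoc_addZero, reassoc_of% addHom_comp, Category.id_comp, Category.comp_id,
    ← add_mulZero, ← Category.id_comp (𝟙 (A ⊗ᵣ X)), ← addHom_comp, Category.assoc,
    ← reassoc_of% addAssoc_natural, addHom_id, reassoc_of% addHom_comp, Category.comp_id,
    Category.id_comp]

/-- The mediator exchanges the two mixed terms and then applies the symmetry of `⊗` termwise. The
equation holds because expanding on the left first or on the right first agrees up to `addMiddle`,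
by `distrib_distribRight_addMiddle`. -/
theorem expand_mulSwap (A H A' H' : C) :
    ∃ m : (H ⊗ᵣ A') ⊕ᵣ (A ⊗ᵣ H') ⊕ᵣ (H ⊗ᵣ H') ⟶ (H' ⊗ᵣ A) ⊕ᵣ (A' ⊗ᵣ H) ⊕ᵣ (H' ⊗ᵣ H),
      (expand A H A' H').hom ≫ ((mulSwap A A').hom ⊕ₕ m) =
        (mulSwap (A ⊕ᵣ H) (A' ⊕ᵣ H')).hom ≫ (expand A' H' A H).hom := by
  refine ⟨((addAssoc _ _ _).inv ≫ ((addSwap (H ⊗ᵣ A') (A ⊗ᵣ H')).hom ⊕ₕ 𝟙 (H ⊗ᵣ H')) ≫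
    (addAssoc _ _ _).hom) ≫
      ((mulSwap A H').hom ⊕ₕ ((mulSwap H A').hom ⊕ₕ (mulSwap H H').hom)), ?_⟩
  rw [expand_hom A' H', reassoc_of% mulSwap_distrib, reassoc_of% addHom_comp,
    mulSwap_distribRight, mulSwap_distribRight, ← addHom_comp]
  simp only [Category.assoc]
  rw [← reassoc_of% distrib_distribRight_addMiddle, addAssoc_natural, reassoc_of% addMiddle_eq,
    addHom_comp, Category.id_comp, expand_hom]
  simp only [Category.assoc]

theorem ofHom_comp_inj' {A B H K : C} (f : A ⟶ B) (h : H ⟶ K) :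
    ofHom f ≫ inj B K = inj A H ≫ ofHom (f ⊕ₕ h) := ofHom_comp_inj f h

theorem inj_comp_ofHom_comp' {A H B K X : C} (f : A ⊕ᵣ H ⟶ B) (g : B ⊕ᵣ K ⟶ X) :
    (inj A H ≫ ofHom f) ≫ inj B K ≫ ofHom g =
      inj A (H ⊕ᵣ K) ≫ ofHom ((addAssoc A H K).inv ≫ (f ⊕ₕ 𝟙 K) ≫ g) :=
  inj_comp_ofHom_comp f g

theorem inj_comp_ofHom_congr' (A : C) {H K B : C} (h : H ⟶ K) {f : A ⊕ᵣ H ⟶ B} {g : A ⊕ᵣ K ⟶ B}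
    (w : f = (𝟙 A ⊕ₕ h) ≫ g) :
    inj A H ≫ ofHom f = inj A K ≫ ofHom g := inj_comp_ofHom_congr h w

theorem ofHom_eq_inj_comp_ofHom' {A B : C} (f : A ⟶ B) :
    (ofHom f : (⟨A⟩ : RCat C) ⟶ ⟨B⟩) = inj A (zero C) ≫ ofHom ((addZero A).hom ≫ f) :=
  ofHom_eq_inj_comp_ofHom f

/-! ### Functoriality and naturality of `⊗` on `R(C)`. -/

theorem rMul_inj_comp_ofHom {A H B A' H' B' : C} (f : A ⊕ᵣ H ⟶ B) (g : A' ⊕ᵣ H' ⟶ B') :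
    rMul (inj A H ≫ ofHom f) (inj A' H' ≫ ofHom g) =
      inj (A ⊗ᵣ A') ((H ⊗ᵣ A') ⊕ᵣ (A ⊗ᵣ H') ⊕ᵣ (H ⊗ᵣ H')) ≫
        ofHom ((expand A H A' H').inv ≫ (f ⊗ₕ g)) := by
  rw [inj_comp_ofHom, inj_comp_ofHom, inj_comp_ofHom]; rfl

theorem rMul_mulSwap {A B A' B' : RCat C} (f : A ⟶ B) (g : A' ⟶ B') :
    rMul f g ≫ ofHom (mulSwap B.as B'.as).hom = ofHom (mulSwap A.as A'.as).hom ≫ rMul g f := by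
  obtain ⟨H, f, rfl⟩ := exists_eq_inj_comp_ofHom f
  obtain ⟨K, g, rfl⟩ := exists_eq_inj_comp_ofHom g
  obtain ⟨m, h⟩ := expand_mulSwap A.as H A'.as K
  rw [rMul_inj_comp_ofHom, rMul_inj_comp_ofHom, reassoc_of% (ofHom_comp_inj' _ m),
    Category.assoc, ← ofHom_comp, ← ofHom_comp, Category.assoc, mulSwap_natural]
  congr 2
  rw [Iso.inv_comp_eq, reassoc_of% h, Iso.hom_inv_id_assoc]

/-- The mediator of `expand_zero` shrinks the three-term heap, so that only a single distributor is
left to handle. -/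
theorem rMul_id_right {A H B : C} (f : A ⊕ᵣ H ⟶ B) (X : C) :
    rMul (inj A H ≫ ofHom f) (𝟙 (⟨X⟩ : RCat C)) =
      inj (A ⊗ᵣ X) (H ⊗ᵣ X) ≫ ofHom ((distribRight A H X).inv ≫ (f ⊗ₕ 𝟙 X)) := by
  obtain ⟨m, h⟩ := expand_zero A H X
  rw [← ofHom_id, ofHom_eq_inj_comp_ofHom' (𝟙 X), rMul_inj_comp_ofHom]
  refine inj_comp_ofHom_congr' _ m ?_
  rw [Category.comp_id, Iso.inv_comp_eq, reassoc_of% h, Iso.hom_inv_id_assoc, mulHom_comp,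
    Category.id_comp, Category.comp_id]

theorem rMul_id_left_eq {A B : RCat C} (X : RCat C) (f : A ⟶ B) :
    rMul (𝟙 X) f = ofHom (mulSwap X.as A.as).hom ≫ rMul f (𝟙 X) ≫
      ofHom (mulSwap B.as X.as).hom := by
  rw [rMul_mulSwap, ← Category.assoc, ← ofHom_comp, mulSwap_mulSwap, ofHom_id]
  exact (Category.id_comp _).symm

theorem rMul_id_left {A H B : C} (f : A ⊕ᵣ H ⟶ B) (X : C) :
    rMul (𝟙 (⟨X⟩ : RCat C)) (inj A H ≫ ofHom f) =
      inj (X ⊗ᵣ A) (X ⊗ᵣ H) ≫ ofHom ((distrib X A H).inv ≫ (𝟙 X ⊗ₕ f)) := by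
  rw [rMul_id_left_eq, rMul_id_right, Category.assoc,
    reassoc_of% (ofHom_comp_inj' _ (mulSwap X H).hom), ← ofHom_comp, ← ofHom_comp]
  congr 2
  rw [Category.assoc, mulSwap_natural, ← cancel_epi (distrib X A H).hom, Iso.hom_inv_id_assoc,
    ← reassoc_of% mulSwap_distribRight, Iso.hom_inv_id_assoc, reassoc_of% mulSwap_mulSwap]

theorem rMul_eq_right_left {A B A' B' : RCat C} (f : A ⟶ B) (g : A' ⟶ B') :
    rMul f g = rMul f (𝟙 A') ≫ rMul (𝟙 B) g := by
  obtain ⟨H, f, rfl⟩ := exists_eq_inj_comp_ofHom f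
  obtain ⟨K, g, rfl⟩ := exists_eq_inj_comp_ofHom g
  rw [rMul_inj_comp_ofHom, rMul_id_right, rMul_id_left, inj_comp_ofHom_comp']
  -- The composite has heap `(H ⊗ A') ⊕ (B ⊗ K)`. The mediator gathers `(A ⊗ K) ⊕ (H ⊗ K)` into `(A
  -- ⊕ H) ⊗ K` and applies `f`; it is not invertible in general.
  refine inj_comp_ofHom_congr' _ (𝟙 _ ⊕ₕ ((distribRight _ _ _).inv ≫ (f ⊗ₕ 𝟙 K))) ?_
  rw [reassoc_of% addAssoc_inv_natural, reassoc_of% addHom_comp, Category.comp_id, addHom_id,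
    Category.id_comp, ← addHom_comp, Category.assoc, reassoc_of% distrib_inv_natural,
    mulHom_comp, addHom_id, Category.id_comp, Category.comp_id, expand_inv, Category.assoc,
    Category.assoc]

/-- This is `rMul_eq_right_left` for `g` and `f`, conjugated by the symmetry. -/
theorem rMul_eq_left_right {A B A' B' : RCat C} (f : A ⟶ B) (g : A' ⟶ B') :
    rMul f g = rMul (𝟙 A) g ≫ rMul f (𝟙 B') := by
  have h := rMul_mulSwap f g
  rw [rMul_eq_right_left g f, ← reassoc_of% (rMul_mulSwap (𝟙 A) g),
    ← rMul_mulSwap f (𝟙 B')] at h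
  have h' := congrArg (· ≫ ofHom (mulSwap B'.as B.as).hom) h
  simp only [Category.assoc] at h'
  rw [← ofHom_comp, mulSwap_mulSwap, ofHom_id] at h'
  exact (Category.comp_id _).symm.trans (h'.trans (congrArg (_ ≫ ·) (Category.comp_id _)))

theorem distribRight_inv_addAssoc (A B X Y : C) :
    (𝟙 (A ⊗ᵣ Y) ⊕ₕ (distribRight B X Y).hom) ≫ (addAssoc _ _ _).inv ≫
      ((distribRight A B Y).inv ⊕ₕ 𝟙 (X ⊗ᵣ Y)) ≫ (distribRight (A ⊕ᵣ B) X Y).inv =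
    (distribRight A (B ⊕ᵣ X) Y).inv ≫ ((addAssoc A B X).inv ⊗ₕ 𝟙 Y) := by
  rw [← cancel_epi (distribRight A (B ⊕ᵣ X) Y).hom, Iso.hom_inv_id_assoc,
    ← cancel_epi (mulIso (addAssoc A B X) (Iso.refl Y)).hom]
  change ((addAssoc A B X).hom ⊗ₕ 𝟙 Y) ≫ _ = ((addAssoc A B X).hom ⊗ₕ 𝟙 Y) ≫ _
  rw [← reassoc_of% distribRight_addAssoc, Iso.hom_inv_id_assoc, reassoc_of% addHom_comp,
    Iso.hom_inv_id, Category.comp_id, addHom_id, Category.id_comp, Iso.hom_inv_id, mulHom_comp,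
    Iso.hom_inv_id, Category.comp_id, mulHom_id]

/-- The mediator distributes `Y` over the heap `H ⊕ K` of the composite; the equation comes from the
law `distribRight_addAssoc`. -/
theorem rMul_comp_id {A B X : RCat C} (f : A ⟶ B) (g : B ⟶ X) (Y : RCat C) :
    rMul (f ≫ g) (𝟙 Y) = rMul f (𝟙 Y) ≫ rMul g (𝟙 Y) := by
  obtain ⟨H, f, rfl⟩ := exists_eq_inj_comp_ofHom f
  obtain ⟨K, g, rfl⟩ := exists_eq_inj_comp_ofHom g
  rw [inj_comp_ofHom_comp', rMul_id_right, rMul_id_right, rMul_id_right, inj_comp_ofHom_comp']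
  refine inj_comp_ofHom_congr' _ (distribRight _ _ _).hom ?_
  rw [← Category.id_comp (𝟙 (K ⊗ᵣ Y.as)), ← addHom_comp, Category.assoc, ← mulHom_id K,
    reassoc_of% distribRight_inv_natural, mulHom_id K,
    reassoc_of% distribRight_inv_addAssoc, mulHom_comp, mulHom_comp, Category.id_comp,
    Category.id_comp]

theorem rMul_id_comp {A B X : RCat C} (f : A ⟶ B) (g : B ⟶ X) (Y : RCat C) :
    rMul (𝟙 Y) (f ≫ g) = rMul (𝟙 Y) f ≫ rMul (𝟙 Y) g := by
  rw [rMul_id_left_eq, rMul_comp_id, rMul_id_left_eq, Category.assoc, rMul_mulSwap g,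
    Category.assoc, Category.assoc]

/-- After splitting, the middle factors `1 ⊗ f'` and `g ⊗ 1` trade places because both orders
compute `g ⊗ f'`. -/
theorem rMul_comp {A B X A' B' X' : RCat C} (f : A ⟶ B) (f' : A' ⟶ B') (g : B ⟶ X)
    (g' : B' ⟶ X') : rMul f f' ≫ rMul g g' = rMul (f ≫ g) (f' ≫ g') := by
  rw [rMul_eq_right_left f, rMul_eq_right_left g, rMul_eq_right_left (f ≫ g), rMul_comp_id,
    rMul_id_comp, Category.assoc, Category.assoc, ← reassoc_of% (rMul_eq_left_right g f'),
    ← reassoc_of% (rMul_eq_right_left g f')]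

/-- The heap here is `0 ⊗ X`, replaced by `0` through the annihilator; the law is `addZero_mul`. -/
theorem rMul_ofHom_id {A B : C} (f : A ⟶ B) (X : C) :
    rMul (ofHom f) (𝟙 (⟨X⟩ : RCat C)) = ofHom (f ⊗ₕ 𝟙 X) := by
  rw [ofHom_eq_inj_comp_ofHom' f, rMul_id_right, ofHom_eq_inj_comp_ofHom' (f ⊗ₕ 𝟙 X)]
  refine (inj_comp_ofHom_congr' _ (zeroMul X).inv ?_).symm
  rw [← Category.comp_id (𝟙 X), ← mulHom_comp, ← addZero_mul, Category.comp_id]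
  simp only [Category.assoc]
  rw [Iso.inv_hom_id_assoc, reassoc_of% addHom_comp, Iso.inv_hom_id, Category.comp_id, addHom_id,
    Category.id_comp]

theorem rMul_ofHom {A B A' B' : C} (f : A ⟶ B) (g : A' ⟶ B') :
    rMul (ofHom f) (ofHom g) = (ofHom (f ⊗ₕ g) : (⟨A ⊗ᵣ A'⟩ : RCat C) ⟶ ⟨B ⊗ᵣ B'⟩) := by
  rw [rMul_eq_right_left, rMul_id_left_eq, rMul_ofHom_id, rMul_ofHom_id, ← ofHom_comp,
    ← ofHom_comp, ← ofHom_comp, mulSwap_natural, reassoc_of% mulSwap_mulSwap, mulHom_comp,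
    Category.comp_id, Category.id_comp]

theorem distribRight_inv_mulAssoc (A B X Y : C) :
    (distribRight (A ⊗ᵣ X) (B ⊗ᵣ X) Y).inv ≫ ((distribRight A B X).inv ⊗ₕ 𝟙 Y) ≫
        (mulAssoc (A ⊕ᵣ B) X Y).hom =
      ((mulAssoc A X Y).hom ⊕ₕ (mulAssoc B X Y).hom) ≫ (distribRight A B (X ⊗ᵣ Y)).inv := by
  rw [Iso.eq_comp_inv, Category.assoc, Category.assoc, ← distribRight_mulAssoc,
    reassoc_of% mulHom_comp, Iso.inv_hom_id, Category.id_comp, mulHom_id, Category.id_comp,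
    Iso.inv_hom_id_assoc]

theorem distrib_inv_mulAssoc (A B X Y : C) :
    (distrib (A ⊗ᵣ B) X Y).inv ≫ (mulAssoc A B (X ⊕ᵣ Y)).hom =
      ((mulAssoc A B X).hom ⊕ₕ (mulAssoc A B Y).hom) ≫ (distrib A (B ⊗ᵣ X) (B ⊗ᵣ Y)).inv ≫
        (𝟙 A ⊗ₕ (distrib B X Y).inv) := by
  rw [Iso.inv_comp_eq, reassoc_of% distrib_mulAssoc, Iso.hom_inv_id_assoc, mulHom_comp,
    Iso.hom_inv_id, Category.comp_id, mulHom_id, Category.comp_id]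

theorem distribRight_inv_distrib_inv_mulAssoc (A B X Y : C) :
    (distribRight (A ⊗ᵣ B) (A ⊗ᵣ X) Y).inv ≫ ((distrib A B X).inv ⊗ₕ 𝟙 Y) ≫
        (mulAssoc A (B ⊕ᵣ X) Y).hom =
      ((mulAssoc A B Y).hom ⊕ₕ (mulAssoc A X Y).hom) ≫ (distrib A (B ⊗ᵣ Y) (X ⊗ᵣ Y)).inv ≫
        (𝟙 A ⊗ₕ (distribRight B X Y).inv) := by
  rw [Iso.inv_comp_eq, ← cancel_epi (mulIso (distrib A B X) (Iso.refl Y)).hom]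
  change ((distrib A B X).hom ⊗ₕ 𝟙 Y) ≫ _ = ((distrib A B X).hom ⊗ₕ 𝟙 Y) ≫ _
  rw [reassoc_of% distrib_distribRight_mulAssoc, Iso.hom_inv_id_assoc, mulHom_comp,
    Iso.hom_inv_id, Category.comp_id, mulHom_id, Category.comp_id, reassoc_of% mulHom_comp,
    Iso.hom_inv_id, Category.comp_id, mulHom_id, Category.id_comp]

/-- This and the next two lemmas treat one variable of the associator each. They rest on
`distribRight_mulAssoc`, `distrib_distribRight_mulAssoc` and `distrib_mulAssoc` respectively. -/
theorem rMul_rMul_id_id {A B : RCat C} (f : A ⟶ B) (X Y : RCat C) :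
    rMul (rMul f (𝟙 X)) (𝟙 Y) ≫ ofHom (mulAssoc B.as X.as Y.as).hom =
      ofHom (mulAssoc A.as X.as Y.as).hom ≫ rMul f (𝟙 (⟨X.as ⊗ᵣ Y.as⟩ : RCat C)) := by
  obtain ⟨H, f, rfl⟩ := exists_eq_inj_comp_ofHom f
  rw [rMul_id_right, rMul_id_right, rMul_id_right,
    reassoc_of% (ofHom_comp_inj' _ (mulAssoc H X.as Y.as).hom), Category.assoc, ← ofHom_comp,
    ← ofHom_comp]
  congr 2
  rw [← reassoc_of% distribRight_inv_mulAssoc, ← mulHom_id X.as, ← mulAssoc_natural,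
    reassoc_of% mulHom_comp, Category.id_comp, Category.assoc]

theorem rMul_id_rMul_id {A B : RCat C} (X : RCat C) (f : A ⟶ B) (Y : RCat C) :
    rMul (rMul (𝟙 X) f) (𝟙 Y) ≫ ofHom (mulAssoc X.as B.as Y.as).hom =
      ofHom (mulAssoc X.as A.as Y.as).hom ≫ rMul (𝟙 X) (rMul f (𝟙 Y)) := by
  obtain ⟨H, f, rfl⟩ := exists_eq_inj_comp_ofHom f
  rw [rMul_id_right, rMul_id_left, rMul_id_right, rMul_id_left,
    reassoc_of% (ofHom_comp_inj' _ (mulAssoc X.as H Y.as).hom), Category.assoc, ← ofHom_comp,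
    ← ofHom_comp]
  congr 2
  rw [← mulHom_comp_id, Category.assoc, Category.assoc, mulAssoc_natural,
    reassoc_of% distribRight_inv_distrib_inv_mulAssoc, ← mulHom_id_comp]

theorem rMul_id_id_rMul {A B : RCat C} (X Y : RCat C) (f : A ⟶ B) :
    rMul (𝟙 (⟨X.as ⊗ᵣ Y.as⟩ : RCat C)) f ≫ ofHom (mulAssoc X.as Y.as B.as).hom =
      ofHom (mulAssoc X.as Y.as A.as).hom ≫ rMul (𝟙 X) (rMul (𝟙 Y) f) := by
  obtain ⟨H, f, rfl⟩ := exists_eq_inj_comp_ofHom f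
  rw [rMul_id_left, rMul_id_left, rMul_id_left,
    reassoc_of% (ofHom_comp_inj' _ (mulAssoc X.as Y.as H).hom), Category.assoc, ← ofHom_comp,
    ← ofHom_comp]
  congr 2
  rw [Category.assoc, ← mulHom_id, mulAssoc_natural, reassoc_of% distrib_inv_mulAssoc,
    ← mulHom_id_comp]

theorem rMul_mulAssoc {A B X A' B' X' : RCat C} (f : A ⟶ A') (g : B ⟶ B') (k : X ⟶ X') :
    rMul (rMul f g) k ≫ ofHom (mulAssoc A'.as B'.as X'.as).hom =
      ofHom (mulAssoc A.as B.as X.as).hom ≫ rMul f (rMul g k) := by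
  rw [rMul_eq_right_left (rMul f g), rMul_eq_right_left f g, rMul_comp_id, Category.assoc,
    Category.assoc, rMul_id_id_rMul, reassoc_of% rMul_id_rMul_id, reassoc_of% rMul_rMul_id_id,
    ← rMul_id_comp, ← rMul_eq_right_left, ← rMul_eq_right_left]

theorem rMul_oneMul {A B : RCat C} (f : A ⟶ B) :
    rMul (𝟙 ⟨one C⟩) f ≫ ofHom (oneMul B.as).hom = ofHom (oneMul A.as).hom ≫ f := by
  obtain ⟨H, f, rfl⟩ := exists_eq_inj_comp_ofHom f
  rw [rMul_id_left, reassoc_of% (ofHom_comp_inj' _ (oneMul H).hom), Category.assoc, ← ofHom_comp,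
    ← ofHom_comp]
  congr 2
  rw [Category.assoc, oneMul_natural, ← one_distrib, Category.assoc, Iso.inv_hom_id_assoc]

theorem rMul_mulOne {A B : RCat C} (f : A ⟶ B) :
    rMul f (𝟙 ⟨one C⟩) ≫ ofHom (mulOne B.as).hom = ofHom (mulOne A.as).hom ≫ f := by
  obtain ⟨H, f, rfl⟩ := exists_eq_inj_comp_ofHom f
  rw [rMul_id_right, reassoc_of% (ofHom_comp_inj' _ (mulOne H).hom), Category.assoc, ← ofHom_comp,
    ← ofHom_comp]
  congr 2
  rw [Category.assoc, mulOne_natural, ← distribRight_one, Category.assoc, Iso.inv_hom_id_assoc]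

/-! ### The symmetric monoidal structure `⊗` on `R(C)`, and `D` as a strict functor for it. -/

variable (C) in
/-- The monoidal category `(R(C), ⊗, I)`. -/
@[reducible]
def mulMonoidal : MonoidalCategory (RCat C) :=
  letI := mulStruct C
  MonoidalCategory.ofTensorHom
    (id_tensorHom_id := fun A B => by
      refine (rMul_ofHom (𝟙 A.as) (𝟙 B.as)).trans ?_
      rw [mulHom_id]; rfl)
    (id_tensorHom := fun _ _ _ _ => rfl)
    (tensorHom_id := fun _ _ => rfl)
    (tensorHom_comp_tensorHom := fun f f' g g' => rMul_comp f f' g g')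
    (associator_naturality := fun f g k => rMul_mulAssoc f g k)
    (leftUnitor_naturality := fun f => rMul_oneMul f)
    (rightUnitor_naturality := fun f => rMul_mulOne f)
    (pentagon := fun W X Y Z => by
      change rMul (ofHom (mulAssoc _ _ _).hom) (ofHom (𝟙 Z.as)) ≫ ofHom (mulAssoc _ _ _).hom ≫
        rMul (ofHom (𝟙 W.as)) (ofHom (mulAssoc _ _ _).hom) =
        ofHom (mulAssoc _ _ _).hom ≫ ofHom (mulAssoc _ _ _).hom
      rw [rMul_ofHom, rMul_ofHom, ← ofHom_comp, ← ofHom_comp, ← ofHom_comp]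
      exact congrArg ofHom (mul_pentagon _ _ _ _))
    (triangle := fun X Y => by
      change ofHom (mulAssoc _ _ _).hom ≫ rMul (ofHom (𝟙 X.as)) (ofHom (oneMul _).hom) =
        rMul (ofHom (mulOne _).hom) (ofHom (𝟙 Y.as))
      rw [rMul_ofHom, rMul_ofHom, ← ofHom_comp]
      exact congrArg ofHom (mul_triangle _ _))

variable (C) in
/-- The symmetry of `⊗` on `R(C)` is the image of that of `C`. -/
@[reducible]
def mulSymmetric : @SymmetricCategory (RCat C) _ (mulMonoidal C) :=
  letI := mulMonoidal C
  { braiding A B := (embedding C).mapIso (mulSwap A.as B.as)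
    braiding_naturality_right X _ _ f := rMul_mulSwap (𝟙 X) f
    braiding_naturality_left f Z := rMul_mulSwap f (𝟙 Z)
    hexagon_forward X Y Z := by
      change ofHom (mulAssoc _ _ _).hom ≫ ofHom (mulSwap _ _).hom ≫ ofHom (mulAssoc _ _ _).hom =
        rMul (ofHom (mulSwap _ _).hom) (ofHom (𝟙 Z.as)) ≫ ofHom (mulAssoc _ _ _).hom ≫
          rMul (ofHom (𝟙 Y.as)) (ofHom (mulSwap _ _).hom)
      rw [rMul_ofHom, rMul_ofHom, ← ofHom_comp, ← ofHom_comp, ← ofHom_comp, ← ofHom_comp]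
      exact congrArg ofHom (mul_hexagon_forward _ _ _)
    hexagon_reverse X Y Z := by
      change ofHom (mulAssoc _ _ _).inv ≫ ofHom (mulSwap _ _).hom ≫ ofHom (mulAssoc _ _ _).inv =
        rMul (ofHom (𝟙 X.as)) (ofHom (mulSwap _ _).hom) ≫ ofHom (mulAssoc _ _ _).inv ≫
          rMul (ofHom (mulSwap _ _).hom) (ofHom (𝟙 Y.as))
      rw [rMul_ofHom, rMul_ofHom, ← ofHom_comp, ← ofHom_comp, ← ofHom_comp, ← ofHom_comp]
      exact congrArg ofHom (mul_hexagon_reverse _ _ _)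
    symmetry X Y := by
      change ofHom (mulSwap X.as Y.as).hom ≫ ofHom (mulSwap Y.as X.as).hom = 𝟙 _
      rw [← ofHom_comp, mulSwap_mulSwap, ofHom_id] }

variable (C) in
/-- The embedding `D : C ⥤ R(C)` is a strict symmetric monoidal functor for `⊗`. -/
@[reducible]
def embeddingMulBraided :
    @Functor.Braided C _ BisymmetricCategory.mul BisymmetricCategory.mulSymm.toBraidedCategory
      (RCat C) _ (mulMonoidal C) (mulSymmetric C).toBraidedCategory (embedding C) :=
  letI := mulMonoidal C
  letI := mulSymmetric C
  @Functor.Braided.mk C _ BisymmetricCategory.mul BisymmetricCategory.mulSymm.toBraidedCategory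
    (RCat C) _ _ _ (embedding C)
    (@Functor.CoreMonoidal.toMonoidal C _ BisymmetricCategory.mul _ _ _ (embedding C)
      (@Functor.CoreMonoidal.mk C _ BisymmetricCategory.mul _ _ _ (embedding C)
        (Iso.refl _)
        (fun _ _ => Iso.refl _)
        (fun f X => by
          refine Eq.trans (b := ofHom (f ⊗ₕ 𝟙 X)) ?_ (Eq.trans ?_ (Category.id_comp _).symm)
          · exact (Category.comp_id _).trans (rMul_ofHom f (𝟙 X))
          · exact congrArg ofHom (mulHom_id_eq_whiskerRight f X))
        (fun X f => by
          refine Eq.trans (b := ofHom (𝟙 X ⊗ₕ f)) ?_ (Eq.trans ?_ (Category.id_comp _).symm)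
          · exact (Category.comp_id _).trans (rMul_ofHom (𝟙 X) f)
          · exact congrArg ofHom (id_mulHom_eq_whiskerLeft X f))
        (fun X Y Z => by
          change rMul (ofHom (𝟙 (X ⊗ᵣ Y))) (ofHom (𝟙 Z)) ≫ 𝟙 _ ≫ ofHom (mulAssoc X Y Z).hom =
            ofHom (mulAssoc X Y Z).hom ≫ rMul (ofHom (𝟙 X)) (ofHom (𝟙 (Y ⊗ᵣ Z))) ≫ 𝟙 _
          rw [Category.id_comp, Category.comp_id, rMul_ofHom, rMul_ofHom, mulHom_id,
            mulHom_id, ← ofHom_comp, ← ofHom_comp, Category.id_comp, Category.comp_id])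
        (fun X => by
          change ofHom (oneMul X).hom =
            rMul (ofHom (𝟙 (one C))) (ofHom (𝟙 X)) ≫ 𝟙 _ ≫ ofHom (oneMul X).hom
          rw [Category.id_comp, rMul_ofHom, mulHom_id, ← ofHom_comp, Category.id_comp])
        (fun X => by
          change ofHom (mulOne X).hom =
            rMul (ofHom (𝟙 X)) (ofHom (𝟙 (one C))) ≫ 𝟙 _ ≫ ofHom (mulOne X).hom
          rw [Category.id_comp, rMul_ofHom, mulHom_id, ← ofHom_comp, Category.id_comp])))
    (fun _ _ => (Category.id_comp _).trans (Category.comp_id _).symm)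

end

end Rig

/-! ### Sums with an identity in `R(C)`. -/

namespace HeapCat

variable {C : Type u} [Category.{v} C] [MonoidalCategory C] [SymmetricCategory C]

theorem tensorμ_unit_comp (A B H : C) :
    tensorμ A B (𝟙_ C) H ≫ ((ρ_ A).hom ▷ (B ⊗ H)) = (A ⊗ B) ◁ (λ_ H).hom ≫ (α_ A B H).hom := by
  simp only [tensorμ, Category.assoc, triangle_assoc_comp_right, braiding_tensorUnit_right]
  monoidal

/-- The unit heap of the identity is absorbed by `λ_ H`, as the annihilators do for products with an
identity. -/
theorem tensor_id_left (A : C) {B H X : C} (f : B ⊗ H ⟶ X) :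
    tensor (𝟙 (⟨A⟩ : HeapCat C)) (inj B H ≫ ofHom f) =
      inj (A ⊗ B) H ≫ ofHom ((α_ A B H).hom ≫ (𝟙 A ⊗ₘ f)) := by
  rw [← ofHom_id, ofHom_eq_inj_comp_ofHom (𝟙 A), tensor_inj_comp_ofHom]
  refine inj_comp_ofHom_congr (λ_ H).hom ?_
  rw [Category.comp_id, MonoidalCategory.tensorHom_def, id_tensorHom, id_tensorHom,
    reassoc_of% tensorμ_unit_comp]

theorem tensor_id_right {A B : HeapCat C} (f : A ⟶ B) (X : HeapCat C) :
    tensor f (𝟙 X) = ofHom (β_ A.as X.as).hom ≫ tensor (𝟙 X) f ≫ ofHom (β_ X.as B.as).hom := by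
  rw [tensor_braiding, ← Category.assoc, ← ofHom_comp, SymmetricCategory.symmetry, ofHom_id]
  exact (Category.id_comp _).symm

theorem tensor_eq_right_left {A B A' B' : HeapCat C} (f : A ⟶ B) (g : A' ⟶ B') :
    tensor f g = tensor f (𝟙 A') ≫ tensor (𝟙 B) g := by
  rw [tensor_comp, Category.comp_id, Category.id_comp]

attribute [local instance] monoidalCategory symmetricCategory

theorem tensorμ_eq_ofHom (A B X Y : HeapCat C) :
    tensorμ A B X Y = ofHom (tensorμ A.as B.as X.as Y.as) := by
  change ofHom (α_ _ _ _).hom ≫ tensor (ofHom (𝟙 A.as)) (ofHom (α_ _ _ _).inv) ≫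
    tensor (ofHom (𝟙 A.as)) (tensor (ofHom (β_ _ _).hom) (ofHom (𝟙 Y.as))) ≫
    tensor (ofHom (𝟙 A.as)) (ofHom (α_ _ _ _).hom) ≫ ofHom (α_ _ _ _).inv = _
  rw [tensor_ofHom, tensor_ofHom, tensor_ofHom, tensor_ofHom, ← ofHom_comp, ← ofHom_comp,
    ← ofHom_comp, ← ofHom_comp, id_tensorHom, id_tensorHom, id_tensorHom, tensorHom_id]
  rfl

end HeapCat

/-! ### Naturality of distributors and annihilators in `R(C)`. -/

namespace Rig

section

attribute [local instance] BisymmetricCategory.add BisymmetricCategory.addSymm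

open HeapCat RigCategoryData RigCategory

variable {C : Type u} [Category.{v} C] [RigCategory C]

theorem tensor_inj_comp_ofHom' {A H B A' H' B' : C} (f : A ⊕ᵣ H ⟶ B) (g : A' ⊕ᵣ H' ⟶ B') :
    tensor (inj A H ≫ ofHom f) (inj A' H' ≫ ofHom g) =
      inj (A ⊕ᵣ A') (H ⊕ᵣ H') ≫ ofHom (addMiddle A A' H H' ≫ (f ⊕ₕ g)) :=
  tensor_inj_comp_ofHom f g

theorem tensor_ofHom' {A B A' B' : C} (f : A ⟶ B) (g : A' ⟶ B') :
    tensor (ofHom f) (ofHom g) = ofHom (f ⊕ₕ g) := tensor_ofHom f g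

theorem tensor_id_left' (A : C) {B H X : C} (f : B ⊕ᵣ H ⟶ X) :
    tensor (𝟙 (⟨A⟩ : RCat C)) (inj B H ≫ ofHom f) =
      inj (A ⊕ᵣ B) H ≫ ofHom ((addAssoc A B H).hom ≫ (𝟙 A ⊕ₕ f)) := tensor_id_left A f

theorem tensor_addSwap {A B A' B' : RCat C} (f : A ⟶ B) (g : A' ⟶ B') :
    tensor f g ≫ ofHom (addSwap B.as B'.as).hom = ofHom (addSwap A.as A'.as).hom ≫ tensor g f :=
  tensor_braiding f g

theorem tensor_id_right' {A B : RCat C} (f : A ⟶ B) (X : RCat C) :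
    tensor f (𝟙 X) =
      ofHom (addSwap A.as X.as).hom ≫ tensor (𝟙 X) f ≫ ofHom (addSwap X.as B.as).hom :=
  tensor_id_right f X

theorem addSwap_addSwap (A B : C) : (addSwap A B).hom ≫ (addSwap B A).hom = 𝟙 (A ⊕ᵣ B) :=
  SymmetricCategory.symmetry A B

theorem addZero_zero : (addZero (zero C)).hom = (zeroAdd (zero C)).hom :=
  unitors_equal.symm

theorem distribRight_inv_distrib (A B X Y : C) :
    (distribRight A B (X ⊕ᵣ Y)).inv ≫ (distrib (A ⊕ᵣ B) X Y).hom =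
      ((distrib A X Y).hom ⊕ₕ (distrib B X Y).hom) ≫
        addMiddle (A ⊗ᵣ X) (A ⊗ᵣ Y) (B ⊗ᵣ X) (B ⊗ᵣ Y) ≫
          ((distribRight A B X).inv ⊕ₕ (distribRight A B Y).inv) := by
  rw [Iso.inv_comp_eq, ← reassoc_of% distrib_distribRight_addMiddle,
    reassoc_of% addMiddle_addMiddle, addHom_hom_inv, Category.comp_id]

/-- On the right the heap of `f` occurs twice, as `H ⊗ X` and `H ⊗ Y`; the mediator `distrib H X Y`
splits the single heap `H ⊗ (X ⊕ Y)`. -/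
theorem rMul_id_right_distrib {A B : RCat C} (f : A ⟶ B) (X Y : RCat C) :
    rMul f (𝟙 (⟨X.as ⊕ᵣ Y.as⟩ : RCat C)) ≫ ofHom (distrib B.as X.as Y.as).hom =
      ofHom (distrib A.as X.as Y.as).hom ≫ tensor (rMul f (𝟙 X)) (rMul f (𝟙 Y)) := by
  obtain ⟨H, f, rfl⟩ := exists_eq_inj_comp_ofHom f
  rw [rMul_id_right, rMul_id_right, rMul_id_right, tensor_inj_comp_ofHom',
    reassoc_of% (ofHom_comp_inj' _ (distrib H X.as Y.as).hom), Category.assoc, ← ofHom_comp,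
    ← ofHom_comp]
  congr 2
  rw [← addHom_comp, ← reassoc_of% distribRight_inv_distrib, ← distrib_natural, addHom_id,
    Category.assoc]

/-- Both sides have heap `A ⊗ K`, so the mediator is an identity and the equation is
`distrib_addAssoc`. -/
theorem rMul_id_left_distrib (A X : RCat C) {Y Z : RCat C} (k : Y ⟶ Z) :
    rMul (𝟙 A) (tensor (𝟙 X) k) ≫ ofHom (distrib A.as X.as Z.as).hom =
      ofHom (distrib A.as X.as Y.as).hom ≫ tensor (rMul (𝟙 A) (𝟙 X)) (rMul (𝟙 A) k) := by
  obtain ⟨K, k, rfl⟩ := exists_eq_inj_comp_ofHom k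
  have e : rMul (𝟙 A) (𝟙 X) = 𝟙 (⟨A.as ⊗ᵣ X.as⟩ : RCat C) :=
    (rMul_ofHom (𝟙 A.as) (𝟙 X.as)).trans (by rw [mulHom_id, ofHom_id])
  rw [e, tensor_id_left', rMul_id_left, rMul_id_left, tensor_id_left',
    reassoc_of% (ofHom_comp_inj' _ (𝟙 (A.as ⊗ᵣ K))), Category.assoc, ← ofHom_comp, ← ofHom_comp]
  congr 2
  rw [← mulHom_id_comp, Category.assoc, Category.assoc, distrib_natural, Iso.inv_comp_eq,
    reassoc_of% distrib_addAssoc, addHom_comp, Iso.hom_inv_id_assoc, Category.id_comp, mulHom_id]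

theorem rMul_distrib {A A' X X' Y Y' : RCat C} (f : A ⟶ A') (g : X ⟶ X') (k : Y ⟶ Y') :
    rMul f (tensor g k) ≫ ofHom (distrib A'.as X'.as Y'.as).hom =
      ofHom (distrib A.as X.as Y.as).hom ≫ tensor (rMul f g) (rMul f k) := by
  -- Naturality in the middle variable follows from that in the last one by conjugating with the
  -- symmetry of `⊕`, using `distrib_addSwap`.
  have h : rMul (𝟙 A') (tensor g (𝟙 Y)) ≫ ofHom (distrib A'.as X'.as Y.as).hom =
      ofHom (distrib A'.as X.as Y.as).hom ≫ tensor (rMul (𝟙 A') g) (rMul (𝟙 A') (𝟙 Y)) := by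
    have e (X Y : RCat C) : rMul (𝟙 A') (ofHom (addSwap X.as Y.as).hom) =
        ofHom (𝟙 A'.as ⊗ₕ (addSwap X.as Y.as).hom) := rMul_ofHom (𝟙 A'.as) _
    rw [tensor_id_right' g Y, rMul_id_comp, rMul_id_comp, e, e, Category.assoc, Category.assoc,
      ← ofHom_comp, ← distrib_addSwap, ofHom_comp, reassoc_of% rMul_id_left_distrib,
      tensor_addSwap, ← Category.assoc, ← Category.assoc, ← ofHom_comp,
      ← distrib_addSwap, ← ofHom_comp, Category.assoc, addSwap_addSwap, Category.comp_id]
  rw [rMul_eq_right_left f (tensor g k), tensor_eq_right_left g k, rMul_id_comp, Category.assoc,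
    Category.assoc, rMul_id_left_distrib, reassoc_of% h, reassoc_of% rMul_id_right_distrib,
    tensor_comp, tensor_comp]
  simp only [rMul_comp, Category.id_comp, Category.comp_id]

/-- The mediator annihilates the heap `H ⊗ 0`; the equation is `add_mulZero`. -/
theorem rMul_mulZero {A B : RCat C} (f : A ⟶ B) :
    rMul f (𝟙 (⟨zero C⟩ : RCat C)) ≫ ofHom (mulZero B.as).hom = ofHom (mulZero A.as).hom := by
  obtain ⟨H, f, rfl⟩ := exists_eq_inj_comp_ofHom f
  rw [rMul_id_right, Category.assoc, ← ofHom_comp, Category.assoc, mulZero_natural, ← add_mulZero,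
    Iso.inv_hom_id_assoc, ofHom_eq_inj_comp_ofHom' (mulZero A.as).hom]
  refine inj_comp_ofHom_congr' _ (mulZero H).hom ?_
  rw [← addZero_natural, reassoc_of% addHom_comp, Category.id_comp, Category.comp_id, addZero_zero]

variable (C) in
/-- The data of the rig category `R(C)`. -/
@[reducible]
def rigCategoryData : RigCategoryData (RCat C) where
  add := monoidalCategory C
  addSymm := symmetricCategory C
  mul := mulMonoidal C
  mulSymm := mulSymmetric C
  distrib A B X := (embedding C).mapIso (distrib A.as B.as X.as)
  mulZero A := (embedding C).mapIso (mulZero A.as)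

end

/-! ### Laplaza's laws in `R(C)` as images of those in `C`. -/

section

open HeapCat RigCategoryData RigCategory

variable {C : Type u} [Category.{v} C] [RigCategory C]

attribute [local instance] BisymmetricCategory.add rigCategoryData

/-- `IsImage f f'` says that the morphism `f` of `R(C)` is the image of `f'`. -/
def IsImage {A B : RCat C} (f : A ⟶ B) (f' : A.as ⟶ B.as) : Prop := f = (embedding C).map f'

namespace IsImage

theorem eq {A B : RCat C} {f g : A ⟶ B} {f' g' : A.as ⟶ B.as} (hf : IsImage f f')
    (hg : IsImage g g') (h : f' = g') : f = g := by
  exact hf.trans ((congrArg _ h).trans hg.symm)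

theorem comp {A B X : RCat C} {f : A ⟶ B} {g : B ⟶ X} {f' : A.as ⟶ B.as} {g' : B.as ⟶ X.as}
    (hf : IsImage f f') (hg : IsImage g g') : IsImage (f ≫ g) (f' ≫ g') := by
  obtain rfl := hf
  obtain rfl := hg
  exact ((embedding C).map_comp f' g').symm

theorem add {A B A' B' : RCat C} {f : A ⟶ B} {g : A' ⟶ B'} {f' : A.as ⟶ B.as}
    {g' : A'.as ⟶ B'.as} (hf : IsImage f f') (hg : IsImage g g') :
    IsImage (f ⊕ₕ g) (f' ⊕ₕ g') := by
  obtain rfl := hf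
  obtain rfl := hg
  exact tensor_ofHom' f' g'

theorem mul {A B A' B' : RCat C} {f : A ⟶ B} {g : A' ⟶ B'} {f' : A.as ⟶ B.as}
    {g' : A'.as ⟶ B'.as} (hf : IsImage f f') (hg : IsImage g g') :
    IsImage (f ⊗ₕ g) (f' ⊗ₕ g') := by
  obtain rfl := hf
  obtain rfl := hg
  exact rMul_ofHom f' g'

theorem distribRight_hom (A B X : RCat C) :
    IsImage (distribRight A B X).hom (distribRight A.as B.as X.as).hom :=
  comp (f := (mulSwap (A ⊕ᵣ B) X).hom) rfl
    (comp (f := (distrib X A B).hom) rfl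
      (add (f := (mulSwap X A).hom) (g := (mulSwap X B).hom) rfl rfl))

theorem zeroMul_hom (A : RCat C) : IsImage (zeroMul A).hom (zeroMul A.as).hom :=
  comp (f := (mulSwap (zero (RCat C)) A).hom) (g := (mulZero A).hom) rfl rfl

theorem addMiddle_hom (A B X Y : RCat C) :
    IsImage (addMiddle A B X Y) (addMiddle A.as B.as X.as Y.as) :=
  @tensorμ_eq_ofHom C _ BisymmetricCategory.add BisymmetricCategory.addSymm A B X Y

end IsImage

set_option maxHeartbeats 1000000 in
variable (C) in
/-- The rig category `R(C)`. -/
@[reducible]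
def rigCategory : RigCategory (RCat C) := by
  refine
  { rigCategoryData C with
    -- These two naturality laws alone involve arbitrary morphisms, hence heaps; all other laws are
    -- transported along `D`.
    distrib_natural := fun f g k => rMul_distrib f g k
    mulZero_natural := fun f => rMul_mulZero f
    distrib_addSwap := fun A B X => IsImage.eq ?_ ?_ (distrib_addSwap A.as B.as X.as)
    distribRight_addSwap := fun A B X => IsImage.eq ?_ ?_ (distribRight_addSwap A.as B.as X.as)
    distrib_addAssoc := fun A B X Y => IsImage.eq ?_ ?_ (distrib_addAssoc A.as B.as X.as Y.as)
    distribRight_addAssoc := fun A B X Y =>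
      IsImage.eq ?_ ?_ (distribRight_addAssoc A.as B.as X.as Y.as)
    distrib_mulAssoc := fun A B X Y => IsImage.eq ?_ ?_ (distrib_mulAssoc A.as B.as X.as Y.as)
    distribRight_mulAssoc := fun A B X Y =>
      IsImage.eq ?_ ?_ (distribRight_mulAssoc A.as B.as X.as Y.as)
    distrib_distribRight_mulAssoc := fun A B X Y =>
      IsImage.eq ?_ ?_ (distrib_distribRight_mulAssoc A.as B.as X.as Y.as)
    distrib_distribRight_addMiddle := fun A B X Y =>
      IsImage.eq ?_ ?_ (distrib_distribRight_addMiddle A.as B.as X.as Y.as)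
    zeroMul_zero := IsImage.eq ?_ ?_ (zeroMul_zero (C := C))
    zeroMul_add := fun A B => IsImage.eq ?_ ?_ (zeroMul_add A.as B.as)
    add_mulZero := fun A B => IsImage.eq ?_ ?_ (add_mulZero A.as B.as)
    zeroMul_one := IsImage.eq ?_ ?_ (zeroMul_one (C := C))
    one_mulZero := IsImage.eq ?_ ?_ (one_mulZero (C := C))
    mul_mulZero := fun A B => IsImage.eq ?_ ?_ (mul_mulZero A.as B.as)
    mulZero_zeroMul := fun A B => IsImage.eq ?_ ?_ (mulZero_zeroMul A.as B.as)
    zeroMul_mul := fun A B => IsImage.eq ?_ ?_ (zeroMul_mul A.as B.as)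
    mul_zeroAdd := fun A B => IsImage.eq ?_ ?_ (mul_zeroAdd A.as B.as)
    mul_addZero := fun A B => IsImage.eq ?_ ?_ (mul_addZero A.as B.as)
    zeroAdd_mul := fun A B => IsImage.eq ?_ ?_ (zeroAdd_mul A.as B.as)
    addZero_mul := fun A B => IsImage.eq ?_ ?_ (addZero_mul A.as B.as)
    one_distrib := fun A B => IsImage.eq ?_ ?_ (one_distrib A.as B.as)
    distribRight_one := fun A B => IsImage.eq ?_ ?_ (distribRight_one A.as B.as) }
  -- Each side is built from images of structure maps by composition, `⊕` and `⊗`, all of which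
  -- preserve images.
  all_goals
    repeat' first
      | with_reducible apply IsImage.add
      | with_reducible apply IsImage.mul
      | with_reducible apply IsImage.comp
      | exact rfl
      | exact IsImage.distribRight_hom _ _ _
      | exact IsImage.zeroMul_hom _
      | exact IsImage.addMiddle_hom _ _ _ _

attribute [local instance] rigCategory BisymmetricCategory.addSymm

/-! ### The embedding as a strict rig functor. -/

variable (C) in
/-- The embedding `D : C ⥤ R(C)` is a rig functor. -/
def embeddingRigFunctor : RigFunctor (embedding C) where
  add := embeddingBraided C
  mul := embeddingMulBraided C
  map_distrib A B X := by
    change rMul (ofHom (𝟙 A)) (ofHom (𝟙 (B ⊕ᵣ X))) ≫ 𝟙 _ ≫ ofHom (distrib A B X).hom =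
      ofHom (distrib A B X).hom ≫ HeapCat.tensor (ofHom (𝟙 (A ⊗ᵣ B))) (ofHom (𝟙 (A ⊗ᵣ X))) ≫ 𝟙 _
    rw [Category.id_comp, Category.comp_id, rMul_ofHom, tensor_ofHom', mulHom_id, addHom_id,
      ← ofHom_comp, ← ofHom_comp, Category.id_comp, Category.comp_id]
  map_mulZero A := by
    change rMul (ofHom (𝟙 A)) (ofHom (𝟙 (zero C))) ≫ 𝟙 _ ≫ ofHom (mulZero A).hom =
      ofHom (mulZero A).hom ≫ 𝟙 _
    rw [Category.id_comp, Category.comp_id, rMul_ofHom, mulHom_id, ← ofHom_comp, Category.id_comp]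

theorem embeddingRigFunctor_isStrict : (embeddingRigFunctor C).IsStrict :=
  ⟨fun _ _ => ⟨rfl, rfl⟩, ⟨rfl, rfl⟩, fun _ _ => ⟨rfl, rfl⟩, ⟨rfl, rfl⟩⟩

end

end Rig

theorem mainTheorem9 (C : Type u) [Category.{v} C] [RigCategory C] :
    ∃ S : RigCategory (Rig.RCat C),
      S.add.toMonoidalCategoryStruct = Rig.addStruct C ∧
      S.mul.toMonoidalCategoryStruct = Rig.mulStruct C ∧
      ∃ φ : RigFunctor (Rig.embedding C), φ.IsStrict :=
  ⟨Rig.rigCategory C, rfl, rfl,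
    @Rig.embeddingRigFunctor C _ _, Rig.embeddingRigFunctor_isStrict⟩
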